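/- Let $G=(V,E)$ be a finite simple undirected graph and $\mathcal X$ a finite non-empty state space. Let $\psi_u:\mathcal X\to(0,\infty)$ ($u\in V$) and $\psi_{uv}:\mathcal X\times\mathcal X\to(0,\infty)$ ($\{u,v\}\in E$, $\psi_{uv}(x,y)=\psi_{vu}(y,x)$) be node and edge potentials, $N(u)$ the set of neighbours of $u$, and $\vec E$ the set of directed edges. A message vector is $m=(m_{uv}(i))_{(u\to v)\in\vec E,\,i\in\mathcal X}$, with Euclidean norm $\|\cdot\|_2$. The belief propagation (BP) update $F$ is $$[F(m)]_{uv}(i)=\kappa_{uv}\sum_{j\in\mathcal X}\psi_{uv}(j,i)\,\psi_u(j)\prod_{w\in N(u)\setminus\{v\}}m_{wu}(j),$$ with $\kappa_{uv}$ chosen such that $\sum_i[F(m)]_{uv}(i)=1$. Put $\beta_{uv}(j)=\sum_i\psi_{uv}(j,i)\psi_u(j)$, $\Gamma_{uv}(i,j)=\psi_{uv}(j,i)\psi_u(j)/\beta_{uv}(j)$, $L_{uv}(i)=\min_j\Gamma_{uv}(i,j)$, $U_{uv}(i)=\max_j\Gamma_{uv}(i,j)$, $$K(\psi)=4\,\frac{\sum_{(u\to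 v)\in\vec E}\max_iU_{uv}(i)}{\sum_{(u\to v)\in\vec E}\min_iL_{uv}(i)},$$ and let $\mathcal B$ be the set of feasible message vectors, i.e. those with $\sum_im_{uv}(i)=1$ and $L_{uv}(i)\le m_{uv}(i)\le U_{uv}(i)$ for all $(u\to v)$ and $i$. Stochastic belief propagation (SBP) with step sizes $\alpha^t\in(0,1]$ starts at a deterministic $m^0$. At each $t=0,1,2,\dots$ it draws, for every directed edge $(u\to v)$, an index $J^{t+1}_{uv}\in\mathcal X$ whose conditional distribution given the past is $$p^t_{uv}(j)\propto\beta_{uv}(j)\prod_{w\in N(u)\setminus\{v\}}m^t_{wu}(j)$$ (no condition is needed on the joint conditional law of the indices of different edges), and sets $m^{t+1}_{uv}=(1-\alpha^t)m^t_{uv}+\alpha^t\,\Gamma_{uv}(\cdot,J^{t+1}_{uv})$. Theorem. Suppose that for some $0<\eta<2$ the BP update satisfies $\|F(m)-F(m')\|_2\le(1-\eta/2)\|m-m'\|_2$ for all $m,m'\in\mathcal B$. (a) $F$ has exactly one fixed point $m^*$ among the message vectors for which every $m_{uv}$ is a probability vector. If $0<\alpha^t\le1$ for all $t$, $\alpha^t=O(1/t)$,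 $\sum_t\alpha^t=\infty$, and all entries of $m^0$ are positive, then $m^t\to m^*$ almost surely. (b) Let $1<\beta<2$, $\alpha^t=\beta/(\eta(t+2))$ with $\beta\le2\eta$ (so that $\alpha^t\le1$ for all $t\ge 0$), and $m^0\in\mathcal B$. Then for all $t\ge1$ $$\frac{\mathbb E\|m^t-m^*\|_2^2}{\|m^*\|_2^2}\le\frac{3^\beta K(\psi)\beta^2}{2^\beta\eta^2(\beta-1)}\cdot\frac1t+\frac{\|m^0-m^*\|_2^2}{\|m^*\|_2^2}\Big(\frac2t\Big)^\beta.$$ (c) Let $\alpha^t=1/(\eta(t+1))$ with $\eta\ge1$ (so that $\alpha^t\le1$ for all $t\ge 0$), and $m^0\in\mathcal B$. Then for all $t\ge1$ $$\frac{\mathbb E\|m^t-m^*\|_2^2}{\|m^*\|_2^2}\le\frac{K(\psi)}{\eta^2}\cdot\frac{1+\log t}{t},$$ and for all $0<\epsilon<1$ and $t\ge2$, with probability at least $1-\epsilon$, $$\frac{\|m^t-m^*\|_2^2}{\|m^*\|_2^2}\le\frac{K(\psi)}{\eta^2}\Big(1+\frac8{\sqrt\epsilon}\Big)\frac{1+\log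 t}{t}.$$ (If $G$ has no edges, the quotients are read as $0$.) -/

import Mathlib

open MeasureTheory ProbabilityTheory Filter Topology Asymptotics

noncomputable section

/-- A pairwise Markov random field on the graph `G` with finite state space `X`: strictly positive
node potentials `ψ_u(x_u)` and, for every edge, a strictly positive edge potential
`edgePot u v x_u x_v = ψ_{uv}(x_u, x_v)`. An undirected edge carries a single potential, hence
`edgePot_symm`. -/
structure PairwiseMRF {V : Type*} (G : SimpleGraph V) (X : Type*) where
  nodePot : V → X → ℝ
  edgePot : V → V → X → X → ℝ
  nodePot_pos : ∀ u x, 0 < nodePot u x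
  edgePot_pos : ∀ u v, G.Adj u v → ∀ x y, 0 < edgePot u v x y
  edgePot_symm : ∀ u v, G.Adj u v → ∀ x y, edgePot u v x y = edgePot v u y x

/-- Vectors of messages: one real number for each directed edge `u → v` (a `Dart` with `fst = u`
and `snd = v`) and each state, with the Euclidean norm. -/
abbrev Messages {V : Type*} (G : SimpleGraph V) (X : Type*) : Type _ :=
  EuclideanSpace ℝ (G.Dart × X)

namespace PairwiseMRF

variable {V X : Type*} [Fintype V] [DecidableEq V] [Fintype X]
  {G : SimpleGraph V} [DecidableRel G.Adj]

/-- The product of incoming messages `∏_{w ∈ N(u) \ {v}} m_{w u}(j)` for the directed edge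
`e = (u → v)`. -/
def incoming (m : Messages G X) (e : G.Dart) (j : X) : ℝ :=
  ∏ f : G.Dart with f.snd = e.fst ∧ f.fst ≠ e.snd, m (f, j)

/-- The unnormalized belief propagation update on `e = (u → v)`:
`∑_j ψ_{uv}(j, i) ψ_u(j) ∏_{w ∈ N(u) \ {v}} m_{w u}(j)`. -/
def bpUnnormalized (Ψ : PairwiseMRF G X) (m : Messages G X) (e : G.Dart) (i : X) : ℝ :=
  ∑ j, Ψ.edgePot e.fst e.snd j i * Ψ.nodePot e.fst j * incoming m e j

/-- The global belief propagation update `F`: on each directed edge the unnormalized update is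
divided by its sum over the states. -/
def bpUpdate (Ψ : PairwiseMRF G X) (m : Messages G X) : Messages G X :=
  WithLp.toLp 2 fun p => Ψ.bpUnnormalized m p.1 p.2 / ∑ i, Ψ.bpUnnormalized m p.1 i

/-- The column sum `β_{uv}(j) = ∑_i ψ_{uv}(j, i) ψ_u(j)`, where `j` is the state of the sending
node `u` and `i` that of the receiving node `v`. -/
def colSum (Ψ : PairwiseMRF G X) (e : G.Dart) (j : X) : ℝ :=
  ∑ i, Ψ.edgePot e.fst e.snd j i * Ψ.nodePot e.fst j

/-- The entry in row `i` and column `j` of the normalized compatibility matrix `Γ_{uv}`. -/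
def normCol (Ψ : PairwiseMRF G X) (e : G.Dart) (i j : X) : ℝ :=
  Ψ.edgePot e.fst e.snd j i * Ψ.nodePot e.fst j / Ψ.colSum e j

/-- The probability mass function from which the column index on the directed edge `e` is drawn
when the current message vector is `m`: proportional to `incoming m e j * colSum e j`. -/
def sampleProb (Ψ : PairwiseMRF G X) (m : Messages G X) (e : G.Dart) (j : X) : ℝ :=
  incoming m e j * Ψ.colSum e j / ∑ k, incoming m e k * Ψ.colSum e k

/-- `IsMessage m`: on every directed edge the message is a probability vector. -/
def IsMessage (m : Messages G X) : Prop :=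
  ∀ e : G.Dart, (∀ i, 0 ≤ m (e, i)) ∧ ∑ i, m (e, i) = 1

/-- Fixed points of belief propagation. -/
def IsBPFixedPoint (Ψ : PairwiseMRF G X) (m : Messages G X) : Prop :=
  IsMessage m ∧ Ψ.bpUpdate m = m

/-- The smallest entry in row `i` of `Γ_{uv}`. -/
def rowMin [Nonempty X] (Ψ : PairwiseMRF G X) (e : G.Dart) (i : X) : ℝ :=
  Finset.univ.inf' Finset.univ_nonempty fun j => Ψ.normCol e i j

/-- The largest entry in row `i` of `Γ_{uv}`. -/
def rowMax [Nonempty X] (Ψ : PairwiseMRF G X) (e : G.Dart) (i : X) : ℝ :=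
  Finset.univ.sup' Finset.univ_nonempty fun j => Ψ.normCol e i j

/-- The set of feasible messages: normalized on every directed edge, with entries between the row
minima and the row maxima of the normalized compatibility matrices. -/
def feasible [Nonempty X] (Ψ : PairwiseMRF G X) : Set (Messages G X) :=
  {m | ∀ e : G.Dart, ∑ i, m (e, i) = 1 ∧ ∀ i, Ψ.rowMin e i ≤ m (e, i) ∧ m (e, i) ≤ Ψ.rowMax e i}

/-- The constant `K(ψ)`, four times the sum over directed edges of the largest entry of `Γ_{uv}`
divided by the sum over directed edges of its smallest entry. -/
def prefactor [Nonempty X] (Ψ : PairwiseMRF G X) : ℝ :=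
  4 * ((∑ e : G.Dart, Finset.univ.sup' Finset.univ_nonempty fun i => Ψ.rowMax e i) /
    (∑ e : G.Dart, Finset.univ.inf' Finset.univ_nonempty fun i => Ψ.rowMin e i))

/-- The contraction condition on the belief propagation update, on feasible messages. -/
def IsContractive [Nonempty X] (Ψ : PairwiseMRF G X) (η : ℝ) : Prop :=
  ∀ m ∈ Ψ.feasible, ∀ m' ∈ Ψ.feasible,
    ‖Ψ.bpUpdate m - Ψ.bpUpdate m'‖ ≤ (1 - η / 2) * ‖m - m'‖

/-- `m` is a run of stochastic belief propagation with step sizes `α` and initial message `m₀`,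
on the probability space `(Ω, μ)`. At iteration `t`, for each directed edge `e`, an index
`J (t + 1) ω e` is drawn from `sampleProb (m t ω) e`, conditionally on the past `ℱ t`, and the
message on `e` is averaged with the selected column of the normalized compatibility matrix. Nothing
is required of the joint conditional law of the indices of different edges (independent draws are
the typical case). -/
structure IsSBP {Ω : Type*} [mΩ : MeasurableSpace Ω] (Ψ : PairwiseMRF G X) (α : ℕ → ℝ)
    (m₀ : Messages G X) (μ : Measure Ω) (ℱ : Filtration ℕ mΩ)
    (m : ℕ → Ω → Messages G X) (J : ℕ → Ω → G.Dart → X) : Prop where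
  init : ∀ ω, m 0 ω = m₀
  adapted : ∀ t, StronglyMeasurable[ℱ t] (m t)
  measurable_index : ∀ t e j, MeasurableSet {ω | J (t + 1) ω e = j}
  condProb_index : ∀ t e j,
    μ[Set.indicator {ω | J (t + 1) ω e = j} (fun _ => (1 : ℝ)) | ℱ t]
      =ᵐ[μ] fun ω => Ψ.sampleProb (m t ω) e j
  update : ∀ t ω e i,
    m (t + 1) ω (e, i) = (1 - α t) * m t ω (e, i) + α t * Ψ.normCol e i (J (t + 1) ω e)

end PairwiseMRF

end

/-! The BP update is the conditional mean of the sampled column, so SBP is stochastic approximation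
for the fixed-point equation of `F`. Each update is a convex combination of columns of `Γ`, so `F`
maps the closed set of feasible messages into itself. Banach's theorem gives a fixed point there,
and every normalized fixed point is feasible, whence uniqueness.

For a feasible start, all iterates stay feasible by convexity. Expanding the square and using the
contraction (`norm_sq_averaging_step_le`) gives `‖m (t+1) - z‖² ≤ (1 - η α) ‖m t - z‖² + 2 · noise +
α² C`. The noise is a bounded martingale difference, and `C` (`feasibleBound`) bounds the squared
distance of two feasible messages. Taking means yields a scalar recursion, solved by
`le_of_recursion_div_add_two` for (b). For (c) the step size makes `t ‖m t - z‖²` telescope along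
every path; the mean bound follows, and Chebyshev's inequality for the accumulated noise gives the
bound in probability. Finally `C ≤ K(ψ) ‖z‖² / 2` turns these into relative errors.

In (a) the start is only positive, and the contraction is not available at infeasible messages. The
trajectory is therefore shifted by `w t = ∏ (1 - α s) • (m₀ - z)`, which makes it start at `z` and
stay feasible. Replacing `F (m t)` by `F (m t - w t)` costs a summable error, by a Lipschitz bound
on a compact set of positive messages. Martingale convergence and
`tendsto_zero_of_le_one_sub_mul_add` then apply. -/

set_option linter.unusedSectionVars false

/-! ### Scalar recursions and the one-step inequality -/

/-- A nonnegative sequence with `Z (t + 1) ≤ (1 - η a t) Z t + e t`, where `∑ a = ∞` and the series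
of the `e t` converges (not necessarily absolutely), tends to zero. -/
theorem tendsto_zero_of_le_one_sub_mul_add {Z a e : ℕ → ℝ} {l η : ℝ} (hZ : ∀ t, 0 ≤ Z t)
    (ha : ∀ t, 0 ≤ a t) (hη : 0 < η) (hns : ¬ Summable a)
    (he : Tendsto (fun n => ∑ s ∈ Finset.range n, e s) atTop (𝓝 l))
    (h : ∀ t, Z (t + 1) ≤ (1 - η * a t) * Z t + e t) : Tendsto Z atTop (𝓝 0) := by
  set S : ℕ → ℝ := fun n => ∑ s ∈ Finset.range n, e s with hS
  have hSs : ∀ t, S (t + 1) = S t + e t := fun t => Finset.sum_range_succ _ _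
  have hstep : ∀ t, Z (t + 1) - S (t + 1) + η * (a t * Z t) ≤ Z t - S t := fun t => by
    have := h t
    rw [hSs]
    linarith
  have hnn : ∀ t, 0 ≤ η * (a t * Z t) := fun t => mul_nonneg hη.le (mul_nonneg (ha t) (hZ t))
  -- Subtracting the partial sums leaves a decreasing sequence, bounded below because convergent
  -- partial sums are bounded above. Hence `Z` itself converges, without absolute convergence of the
  -- errors.
  have hanti : Antitone fun t => Z t - S t := antitone_nat_of_succ_le fun t => by
    linarith [hstep t, hnn t]
  obtain ⟨B, hB⟩ := he.bddAbove_range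
  have hBS : ∀ n, S n ≤ B := fun n => hB ⟨n, rfl⟩
  have hbdd : BddBelow (Set.range fun t => Z t - S t) := by
    refine ⟨-B, ?_⟩
    rintro _ ⟨n, rfl⟩
    have h1 := hBS n
    have h2 := hZ n
    show -B ≤ Z n - S n
    linarith
  have hW := tendsto_atTop_ciInf hanti hbdd
  set w := ⨅ i, (Z i - S i)
  have hZlim : Tendsto Z atTop (𝓝 (w + l)) := by
    have := hW.add he
    refine this.congr fun n => ?_
    show Z n - S n + S n = Z n
    ring
  have hz0 : 0 ≤ w + l := ge_of_tendsto' hZlim hZ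
  rcases hz0.eq_or_lt with h0 | hpos
  · rwa [← h0] at hZlim
  -- With a positive limit, `a t` is eventually at most a constant times the decrease `η a t Z t`,
  -- and these decreases have bounded sums.
  exfalso
  apply hns
  have hsum : ∀ n, ∑ s ∈ Finset.range n, η * (a s * Z s) ≤ Z 0 - S 0 - (Z n - S n) := by
    intro n
    induction n with
    | zero => simp
    | succ n ih =>
      rw [Finset.sum_range_succ]
      linarith [hstep n]
  have hsummable : Summable fun s => η * (a s * Z s) := by
    refine summable_of_sum_range_le (c := Z 0 - S 0 + B) hnn fun n => ?_
    linarith [hsum n, hZ n, hBS n]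
  refine Summable.of_norm_bounded_eventually_nat
    (hsummable.mul_left (2 / ((w + l) * η))) ?_
  filter_upwards [hZlim.eventually (lt_mem_nhds (half_lt_self hpos))] with t ht
  rw [Real.norm_of_nonneg (ha t)]
  have : 2 / ((w + l) * η) * (η * (a t * Z t)) = a t * (Z t / ((w + l) / 2)) := by
    field_simp
  rw [this]
  refine le_mul_of_one_le_right (ha t) ?_
  rw [one_le_div (by positivity)]
  exact ht.le

theorem sum_range_one_div_succ_le (n : ℕ) :
    ∑ s ∈ Finset.range n, 1 / ((s : ℝ) + 1) ≤ 1 + Real.log n := by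
  have h := harmonic_le_one_add_log n
  simpa [harmonic, one_div] using h

/-- The solution of the recursion of order `β / t`, for `β > 1`. -/
theorem le_of_recursion_div_add_two {a : ℕ → ℝ} {β D : ℝ} (hβ1 : 1 < β) (hβ2 : β < 2) (hD : 0 ≤ D)
    (ha0 : 0 ≤ a 0)
    (h : ∀ t : ℕ, a (t + 1) ≤ (1 - β / ((t : ℝ) + 2)) * a t + D / ((t : ℝ) + 2) ^ 2) (t : ℕ) :
    a t ≤ D / (β - 1) / ((t : ℝ) + 1) + a 0 * (2 / ((t : ℝ) + 2)) ^ β := by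
  have hβ' : 0 < β - 1 := by linarith
  induction t with
  | zero =>
    simp only [Nat.cast_zero, zero_add]
    rw [div_self (by norm_num : (2 : ℝ) ≠ 0), Real.one_rpow]
    have : 0 ≤ D / (β - 1) / 1 := by positivity
    linarith
  | succ t ih =>
    have ht : (0 : ℝ) ≤ t := Nat.cast_nonneg t
    have hc : 0 ≤ 1 - β / ((t : ℝ) + 2) := by
      rw [sub_nonneg, div_le_one (by positivity)]
      linarith
    -- The constant `D / (β - 1)` makes `D / (t + 1)` times a supersolution: the slack is exactly `D
    -- / ((t + 1) (t + 2)²)`.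
    have h1 : (1 - β / ((t : ℝ) + 2)) * (D / (β - 1) / ((t : ℝ) + 1)) + D / ((t : ℝ) + 2) ^ 2 ≤
        D / (β - 1) / ((t : ℝ) + 2) := by
      have : D / (β - 1) / ((t : ℝ) + 2) - ((1 - β / ((t : ℝ) + 2)) * (D / (β - 1) / ((t : ℝ) + 1))
          + D / ((t : ℝ) + 2) ^ 2) = D / (((t : ℝ) + 1) * ((t : ℝ) + 2) ^ 2) := by
        field_simp
        ring
      have h2 : 0 ≤ D / (((t : ℝ) + 1) * ((t : ℝ) + 2) ^ 2) := by positivity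
      linarith
    -- Bernoulli's inequality for the exponent `β`, applied to `1 - 1 / (t + 3) = (t + 2) / (t +
    -- 3)`.
    have h2 : (1 - β / ((t : ℝ) + 2)) * (2 / ((t : ℝ) + 2)) ^ β ≤ (2 / ((t : ℝ) + 3)) ^ β := by
      have h3 : 1 + β * (-(1 / ((t : ℝ) + 3))) ≤ (1 + (-(1 / ((t : ℝ) + 3)))) ^ β := by
        refine one_add_mul_self_le_rpow_one_add ?_ hβ1.le
        rw [neg_le_neg_iff, div_le_one (by positivity)]
        linarith
      have h4 : (1 - β / ((t : ℝ) + 2)) ≤ (((t : ℝ) + 2) / ((t : ℝ) + 3)) ^ β := by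
        have e1 : 1 + (-(1 / ((t : ℝ) + 3))) = ((t : ℝ) + 2) / ((t : ℝ) + 3) := by
          field_simp
          ring
        rw [e1] at h3
        refine le_trans ?_ h3
        have : β / ((t : ℝ) + 3) ≤ β / ((t : ℝ) + 2) := by
          gcongr
          norm_num
        have e2 : β * (-(1 / ((t : ℝ) + 3))) = - (β / ((t : ℝ) + 3)) := by ring
        rw [e2]
        linarith
      calc (1 - β / ((t : ℝ) + 2)) * (2 / ((t : ℝ) + 2)) ^ β
          ≤ (((t : ℝ) + 2) / ((t : ℝ) + 3)) ^ β * (2 / ((t : ℝ) + 2)) ^ β := by gcongr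
        _ = (2 / ((t : ℝ) + 3)) ^ β := by
          rw [← Real.mul_rpow (by positivity) (by positivity)]
          congr 1
          field_simp
    push_cast
    have e1 : (t : ℝ) + 1 + 1 = t + 2 := by ring
    have e2 : (t : ℝ) + 1 + 2 = t + 3 := by ring
    rw [e1, e2]
    calc a (t + 1) ≤ (1 - β / ((t : ℝ) + 2)) * a t + D / ((t : ℝ) + 2) ^ 2 := h t
      _ ≤ (1 - β / ((t : ℝ) + 2)) *
          (D / (β - 1) / ((t : ℝ) + 1) + a 0 * (2 / ((t : ℝ) + 2)) ^ β) +
          D / ((t : ℝ) + 2) ^ 2 := by gcongr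
      _ = ((1 - β / ((t : ℝ) + 2)) * (D / (β - 1) / ((t : ℝ) + 1)) + D / ((t : ℝ) + 2) ^ 2) +
          a 0 * ((1 - β / ((t : ℝ) + 2)) * (2 / ((t : ℝ) + 2)) ^ β) := by ring
      _ ≤ _ := by gcongr

/-- One step of stochastic approximation for a map `F` which contracts towards its fixed point `z`.
The sample `N` is compared with the value of `F` at a point `x`. -/
theorem norm_sq_averaging_step_le {E : Type*} [NormedAddCommGroup E] [InnerProductSpace ℝ E]
    {F : E → E} {x b z : E} (N : E) {a η : ℝ} (ha : 0 ≤ a) (hz : F z = z)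
    (hF : ‖F b - F z‖ ≤ (1 - η / 2) * ‖b - z‖) :
    ‖(1 - a) • b + a • N - z‖ ^ 2 ≤ (1 - η * a) * ‖b - z‖ ^ 2 +
      (2 * (a * inner ℝ (b - z) (N - F x)) + 2 * (a * (‖b - z‖ * ‖F x - F b‖)) +
        a ^ 2 * ‖b - N‖ ^ 2) := by
  have e1 : (1 - a) • b + a • N - z = (b - z) - a • (b - N) := by module
  -- The four parts are the deviation, its image under `F`, the error from sampling at `x` instead
  -- of `b`, and the noise. The first two contribute `2 a (1 - (1 - η / 2)) = η a` to the
  -- contraction.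
  have e2 : b - N = (b - z) - (F b - F z) - (F x - F b) - (N - F x) := by
    rw [hz]
    abel
  have h1 : inner ℝ (b - z) (F b - F z) ≤ (1 - η / 2) * ‖b - z‖ ^ 2 := by
    calc inner ℝ (b - z) (F b - F z) ≤ ‖b - z‖ * ‖F b - F z‖ := real_inner_le_norm _ _
      _ ≤ ‖b - z‖ * ((1 - η / 2) * ‖b - z‖) := by gcongr
      _ = _ := by ring
  have h2 : inner ℝ (b - z) (F x - F b) ≤ ‖b - z‖ * ‖F x - F b‖ := real_inner_le_norm _ _
  have h3 : inner ℝ (b - z) (b - N) = ‖b - z‖ ^ 2 - inner ℝ (b - z) (F b - F z) -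
      inner ℝ (b - z) (F x - F b) - inner ℝ (b - z) (N - F x) := by
    conv_lhs => rw [e2]
    rw [inner_sub_right, inner_sub_right, inner_sub_right, real_inner_self_eq_norm_sq]
  rw [e1, norm_sub_sq_real, inner_smul_right, norm_smul, mul_pow, Real.norm_eq_abs, sq_abs, h3]
  have h4 := mul_le_mul_of_nonneg_left h1 ha
  have h5 := mul_le_mul_of_nonneg_left h2 ha
  linarith

/-! ### Bounded martingale differences -/

section MartingaleDifference

variable {Ω : Type*} {mΩ : MeasurableSpace Ω} {μ : Measure Ω} [IsProbabilityMeasure μ]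
  {ℱ : Filtration ℕ mΩ} {ξ : ℕ → Ω → ℝ} {c : ℕ → ℝ}

theorem stronglyMeasurable_sum_range (hm : ∀ t, StronglyMeasurable[ℱ (t + 1)] (ξ t)) (n : ℕ) :
    StronglyMeasurable[ℱ n] fun ω => ∑ s ∈ Finset.range n, ξ s ω :=
  Finset.stronglyMeasurable_fun_sum _ fun s hs =>
    (hm s).mono (ℱ.mono (Nat.succ_le_of_lt (Finset.mem_range.mp hs)))

theorem norm_sum_range_le (hb : ∀ t ω, ‖ξ t ω‖ ≤ c t) (n : ℕ) (ω : Ω) :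
    ‖∑ s ∈ Finset.range n, ξ s ω‖ ≤ ∑ s ∈ Finset.range n, c s :=
  (norm_sum_le _ _).trans (Finset.sum_le_sum fun s _ => hb s ω)

/-- Bounded martingale differences are orthogonal. -/
theorem integral_sum_range_sq (hm : ∀ t, StronglyMeasurable[ℱ (t + 1)] (ξ t))
    (hb : ∀ t ω, ‖ξ t ω‖ ≤ c t) (hc : ∀ t, μ[ξ t | ℱ t] =ᵐ[μ] 0) (n : ℕ) :
    ∫ ω, (∑ s ∈ Finset.range n, ξ s ω) ^ 2 ∂μ =
      ∑ s ∈ Finset.range n, ∫ ω, ξ s ω ^ 2 ∂μ := by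
  have hmΩ : ∀ t, AEStronglyMeasurable (ξ t) μ := fun t =>
    ((hm t).mono (ℱ.le _)).aestronglyMeasurable
  have hint : ∀ t, Integrable (ξ t) μ := fun t => .of_bound (hmΩ t) (c t) (.of_forall (hb t))
  induction n with
  | zero => simp
  | succ n ih =>
    have hM := stronglyMeasurable_sum_range hm n
    have hMΩ := (hM.mono (ℱ.le n)).aestronglyMeasurable (μ := μ)
    have hMb := norm_sum_range_le hb n
    -- The partial sum is known at time `n` and bounded, so it can be pulled out of the conditional
    -- expectation of the next increment.
    have hcross : ∫ ω, (∑ s ∈ Finset.range n, ξ s ω) * ξ n ω ∂μ = 0 := by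
      have h1 := condExp_stronglyMeasurable_mul_of_bound (ℱ.le n) hM (hint n) _
        (.of_forall hMb) (μ := μ)
      rw [← integral_condExp (ℱ.le n)]
      refine integral_eq_zero_of_ae ?_
      filter_upwards [h1, hc n] with ω h2 h3
      have : (μ[fun ω => (∑ s ∈ Finset.range n, ξ s ω) * ξ n ω | ℱ n]) ω = _ := h2
      rw [this, Pi.mul_apply, h3]
      simp
    have i1 : Integrable (fun ω => (∑ s ∈ Finset.range n, ξ s ω) ^ 2) μ :=
      .of_bound (hMΩ.pow 2) ((∑ s ∈ Finset.range n, c s) ^ 2) (.of_forall fun ω => by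
        rw [norm_pow]
        exact pow_le_pow_left₀ (norm_nonneg _) (hMb ω) 2)
    have i2 : Integrable (fun ω => ξ n ω ^ 2) μ :=
      .of_bound ((hmΩ n).pow 2) (c n ^ 2) (.of_forall fun ω => by
        rw [norm_pow]
        exact pow_le_pow_left₀ (norm_nonneg _) (hb n ω) 2)
    have i3 : Integrable (fun ω => (∑ s ∈ Finset.range n, ξ s ω) * ξ n ω) μ :=
      (hint n).bdd_mul hMΩ (.of_forall hMb)
    have e : ∀ ω, (∑ s ∈ Finset.range (n + 1), ξ s ω) ^ 2 =
        (∑ s ∈ Finset.range n, ξ s ω) ^ 2 + 2 * ((∑ s ∈ Finset.range n, ξ s ω) * ξ n ω) +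
          ξ n ω ^ 2 := fun ω => by
      rw [Finset.sum_range_succ]
      ring
    simp_rw [e]
    have i12 : Integrable (fun ω => (∑ s ∈ Finset.range n, ξ s ω) ^ 2 +
        2 * ((∑ s ∈ Finset.range n, ξ s ω) * ξ n ω)) μ := i1.add (i3.const_mul 2)
    rw [integral_add i12 i2, integral_add i1 (i3.const_mul 2),
      integral_const_mul, hcross, ih, Finset.sum_range_succ]
    ring

/-- A martingale with bounded increments that is bounded in `L²` converges almost surely. -/
theorem ae_exists_tendsto_sum_range (hm : ∀ t, StronglyMeasurable[ℱ (t + 1)] (ξ t))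
    (hb : ∀ t ω, ‖ξ t ω‖ ≤ c t) (hc : ∀ t, μ[ξ t | ℱ t] =ᵐ[μ] 0)
    (hsum : Summable fun t => c t ^ 2) :
    ∀ᵐ ω ∂μ, ∃ l, Tendsto (fun n => ∑ s ∈ Finset.range n, ξ s ω) atTop (𝓝 l) := by
  have hM := stronglyMeasurable_sum_range hm
  have hMΩ := fun n => ((hM n).mono (ℱ.le n)).aestronglyMeasurable (μ := μ)
  have hMb := norm_sum_range_le hb
  have hMint : ∀ n, Integrable (fun ω => ∑ s ∈ Finset.range n, ξ s ω) μ := fun n =>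
    .of_bound (hMΩ n) _ (.of_forall (hMb n))
  have hmart : Martingale (fun n ω => ∑ s ∈ Finset.range n, ξ s ω) ℱ μ := by
    refine martingale_of_condExp_sub_eq_zero_nat hM hMint fun n => ?_
    have : ((fun ω => ∑ s ∈ Finset.range (n + 1), ξ s ω) - fun ω => ∑ s ∈ Finset.range n, ξ s ω) =
        ξ n := by
      ext ω
      simp [Finset.sum_range_succ]
    rw [this]
    exact hc n
  have hMsq : ∀ n, Integrable (fun ω => (∑ s ∈ Finset.range n, ξ s ω) ^ 2) μ := fun n =>
    .of_bound ((hMΩ n).pow 2) ((∑ s ∈ Finset.range n, c s) ^ 2) (.of_forall fun ω => by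
      rw [norm_pow]
      exact pow_le_pow_left₀ (norm_nonneg _) (hMb n ω) 2)
  have hR : 0 ≤ 1 + ∑' t, c t ^ 2 := by
    have : 0 ≤ ∑' t, c t ^ 2 := tsum_nonneg fun t => sq_nonneg (c t)
    linarith
  -- Submartingale convergence needs an `L¹` bound; `|x| ≤ 1 + x²` obtains it from orthogonality.
  have hbdd : ∀ n, eLpNorm (fun ω => ∑ s ∈ Finset.range n, ξ s ω) 1 μ ≤
      ((1 + ∑' t, c t ^ 2).toNNReal : NNReal) := by
    intro n
    rw [eLpNorm_one_eq_lintegral_enorm, ← ofReal_integral_norm_eq_lintegral_enorm (hMint n)]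
    refine ENNReal.ofReal_le_ofReal ?_
    calc ∫ ω, ‖∑ s ∈ Finset.range n, ξ s ω‖ ∂μ
        ≤ ∫ ω, (1 + (∑ s ∈ Finset.range n, ξ s ω) ^ 2) ∂μ := by
          refine integral_mono (hMint n).norm ((integrable_const 1).add (hMsq n)) fun ω => ?_
          show ‖∑ s ∈ Finset.range n, ξ s ω‖ ≤ 1 + (∑ s ∈ Finset.range n, ξ s ω) ^ 2
          rw [Real.norm_eq_abs, ← sq_abs (∑ s ∈ Finset.range n, ξ s ω)]
          nlinarith [sq_nonneg (|∑ s ∈ Finset.range n, ξ s ω| - 1)]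
      _ = 1 + ∑ s ∈ Finset.range n, ∫ ω, ξ s ω ^ 2 ∂μ := by
          rw [integral_add (integrable_const 1) (hMsq n), integral_sum_range_sq hm hb hc]
          simp
      _ ≤ 1 + ∑ s ∈ Finset.range n, c s ^ 2 := by
          gcongr with s hs
          calc ∫ ω, ξ s ω ^ 2 ∂μ ≤ ∫ _, c s ^ 2 ∂μ := by
                refine integral_mono_of_nonneg (.of_forall fun ω => sq_nonneg _)
                  (integrable_const _) (.of_forall fun ω => ?_)
                show ξ s ω ^ 2 ≤ c s ^ 2
                rw [← sq_abs (ξ s ω)]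
                exact pow_le_pow_left₀ (abs_nonneg _) (hb s ω) 2
            _ = c s ^ 2 := by simp
      _ ≤ 1 + ∑' t, c t ^ 2 := by
          gcongr
          exact hsum.sum_le_tsum _ fun _ _ => sq_nonneg _
  filter_upwards [hmart.submartingale.ae_tendsto_limitProcess hbdd] with ω h
  exact ⟨_, h⟩

end MartingaleDifference

/-! ### Feasible messages and the belief propagation update -/

noncomputable section

namespace PairwiseMRF

variable {V X : Type*} [Fintype V] [DecidableEq V] [Fintype X]
  {G : SimpleGraph V} [DecidableRel G.Adj]

/-- The message vector whose part on each directed edge `e` is the column `x e` of the normalized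
compatibility matrix. -/
def sampledColumn (Ψ : PairwiseMRF G X) (x : G.Dart → X) : Messages G X :=
  WithLp.toLp 2 fun p => Ψ.normCol p.1 p.2 (x p.1)

/-- Twice the sum over directed edges of the largest entry of the normalized compatibility matrix:
a bound for the squared distance of two feasible messages. -/
def feasibleBound [Nonempty X] (Ψ : PairwiseMRF G X) : ℝ :=
  2 * ∑ e : G.Dart, Finset.univ.sup' Finset.univ_nonempty fun i => Ψ.rowMax e i

theorem sampledColumn_apply (Ψ : PairwiseMRF G X) (x : G.Dart → X) (e : G.Dart) (i : X) :
    Ψ.sampledColumn x (e, i) = Ψ.normCol e i (x e) := rfl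

theorem weight_pos (Ψ : PairwiseMRF G X) (e : G.Dart) (i j : X) :
    0 < Ψ.edgePot e.fst e.snd j i * Ψ.nodePot e.fst j :=
  mul_pos (Ψ.edgePot_pos _ _ e.adj _ _) (Ψ.nodePot_pos _ _)

theorem colSum_pos [Nonempty X] (Ψ : PairwiseMRF G X) (e : G.Dart) (j : X) : 0 < Ψ.colSum e j :=
  Finset.sum_pos (fun i _ => Ψ.weight_pos e i j) Finset.univ_nonempty

theorem normCol_pos [Nonempty X] (Ψ : PairwiseMRF G X) (e : G.Dart) (i j : X) :
    0 < Ψ.normCol e i j :=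
  div_pos (Ψ.weight_pos e i j) (Ψ.colSum_pos e j)

theorem sum_normCol [Nonempty X] (Ψ : PairwiseMRF G X) (e : G.Dart) (j : X) :
    ∑ i, Ψ.normCol e i j = 1 := by
  simp only [normCol]
  rw [← Finset.sum_div]
  exact div_self (Ψ.colSum_pos e j).ne'

theorem rowMin_le [Nonempty X] (Ψ : PairwiseMRF G X) (e : G.Dart) (i j : X) :
    Ψ.rowMin e i ≤ Ψ.normCol e i j :=
  Finset.inf'_le _ (Finset.mem_univ j)

theorem le_rowMax [Nonempty X] (Ψ : PairwiseMRF G X) (e : G.Dart) (i j : X) :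
    Ψ.normCol e i j ≤ Ψ.rowMax e i :=
  Finset.le_sup' (fun j => Ψ.normCol e i j) (Finset.mem_univ j)

theorem rowMin_pos [Nonempty X] (Ψ : PairwiseMRF G X) (e : G.Dart) (i : X) :
    0 < Ψ.rowMin e i := by
  rw [rowMin, Finset.lt_inf'_iff]
  exact fun j _ => Ψ.normCol_pos e i j

theorem incoming_nonneg {m : Messages G X} (h : ∀ p, 0 ≤ m p) (e : G.Dart) (j : X) :
    0 ≤ incoming m e j :=
  Finset.prod_nonneg fun _ _ => h _

theorem incoming_pos {m : Messages G X} (h : ∀ p, 0 < m p) (e : G.Dart) (j : X) :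
    0 < incoming m e j :=
  Finset.prod_pos fun _ _ => h _

theorem sum_incoming_mul_colSum_pos [Nonempty X] (Ψ : PairwiseMRF G X) {m : Messages G X}
    (h : ∀ p, 0 < m p) (e : G.Dart) : 0 < ∑ k, incoming m e k * Ψ.colSum e k :=
  Finset.sum_pos (fun k _ => mul_pos (incoming_pos h e k) (Ψ.colSum_pos e k))
    Finset.univ_nonempty

theorem sum_bpUnnormalized (Ψ : PairwiseMRF G X) (m : Messages G X) (e : G.Dart) :
    ∑ i, Ψ.bpUnnormalized m e i = ∑ k, incoming m e k * Ψ.colSum e k := by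
  simp only [bpUnnormalized, colSum]
  rw [Finset.sum_comm]
  refine Finset.sum_congr rfl fun j _ => ?_
  rw [← Finset.sum_mul, mul_comm]

theorem bpUpdate_apply (Ψ : PairwiseMRF G X) (m : Messages G X) (e : G.Dart) (i : X) :
    Ψ.bpUpdate m (e, i) = Ψ.bpUnnormalized m e i / ∑ k, Ψ.bpUnnormalized m e k := rfl

/-- The update is the mean of the sampled column. -/
theorem bpUpdate_eq_sum_sampleProb [Nonempty X] (Ψ : PairwiseMRF G X) (m : Messages G X)
    (e : G.Dart) (i : X) :
    Ψ.bpUpdate m (e, i) = ∑ j, Ψ.normCol e i j * Ψ.sampleProb m e j := by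
  rw [bpUpdate_apply, sum_bpUnnormalized, bpUnnormalized, Finset.sum_div]
  refine Finset.sum_congr rfl fun j _ => ?_
  have := (Ψ.colSum_pos e j).ne'
  rw [sampleProb, normCol, ← mul_div_assoc]
  congr 1
  field_simp

/-- The update averages columns of `Γ` with the weights `sampleProb`, so each entry lies between the
row extremes. Only nonnegative products and a nonzero normalizer are required, so that fixed points
with possible zero entries are covered. -/
theorem bpUpdate_mem_feasible [Nonempty X] (Ψ : PairwiseMRF G X) {m : Messages G X}
    (h : ∀ e j, 0 ≤ incoming m e j) (hs : ∀ e, ∑ k, incoming m e k * Ψ.colSum e k ≠ 0) :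
    Ψ.bpUpdate m ∈ Ψ.feasible := by
  intro e
  have hp : ∀ j, 0 ≤ Ψ.sampleProb m e j := fun j =>
    div_nonneg (mul_nonneg (h e j) (Ψ.colSum_pos e j).le)
      (Finset.sum_nonneg fun k _ => mul_nonneg (h e k) (Ψ.colSum_pos e k).le)
  have hp1 : ∑ j, Ψ.sampleProb m e j = 1 := by
    simp only [sampleProb]
    rw [← Finset.sum_div]
    exact div_self (hs e)
  refine ⟨?_, fun i => ⟨?_, ?_⟩⟩
  · simp only [bpUpdate_apply]
    rw [← Finset.sum_div, sum_bpUnnormalized]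
    exact div_self (hs e)
  · rw [bpUpdate_eq_sum_sampleProb]
    calc Ψ.rowMin e i = ∑ j, Ψ.rowMin e i * Ψ.sampleProb m e j := by
          rw [← Finset.mul_sum, hp1, mul_one]
      _ ≤ _ := Finset.sum_le_sum fun j _ => mul_le_mul_of_nonneg_right (Ψ.rowMin_le e i j) (hp j)
  · rw [bpUpdate_eq_sum_sampleProb]
    calc _ ≤ ∑ j, Ψ.rowMax e i * Ψ.sampleProb m e j :=
          Finset.sum_le_sum fun j _ => mul_le_mul_of_nonneg_right (Ψ.le_rowMax e i j) (hp j)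
      _ = Ψ.rowMax e i := by rw [← Finset.mul_sum, hp1, mul_one]

theorem sampledColumn_mem_feasible [Nonempty X] (Ψ : PairwiseMRF G X) (x : G.Dart → X) :
    Ψ.sampledColumn x ∈ Ψ.feasible := fun e =>
  ⟨Ψ.sum_normCol e (x e), fun i => ⟨Ψ.rowMin_le e i _, Ψ.le_rowMax e i _⟩⟩

theorem pos_of_mem_feasible [Nonempty X] {Ψ : PairwiseMRF G X} {m : Messages G X}
    (hm : m ∈ Ψ.feasible) (p : G.Dart × X) : 0 < m p :=
  (Ψ.rowMin_pos p.1 p.2).trans_le ((hm p.1).2 p.2).1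

theorem bpUpdate_mem_feasible_of_pos [Nonempty X] (Ψ : PairwiseMRF G X) {m : Messages G X}
    (h : ∀ p, 0 < m p) : Ψ.bpUpdate m ∈ Ψ.feasible :=
  Ψ.bpUpdate_mem_feasible (fun e j => (incoming_pos h e j).le)
    fun e => (Ψ.sum_incoming_mul_colSum_pos h e).ne'

theorem convex_feasible [Nonempty X] (Ψ : PairwiseMRF G X) : Convex ℝ Ψ.feasible := by
  intro x hx y hy a b ha hb hab e
  have happ : ∀ i, (a • x + b • y) (e, i) = a * x (e, i) + b * y (e, i) := fun i => rfl
  refine ⟨?_, fun i => ?_⟩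
  · simp only [happ]
    rw [Finset.sum_add_distrib, ← Finset.mul_sum, ← Finset.mul_sum, (hx e).1, (hy e).1]
    linarith
  · rw [happ]
    exact (convex_Icc (Ψ.rowMin e i) (Ψ.rowMax e i)) ((hx e).2 i) ((hy e).2 i) ha hb hab

theorem isClosed_feasible [Nonempty X] (Ψ : PairwiseMRF G X) : IsClosed Ψ.feasible := by
  simp only [feasible, Set.ofPred_forall, Set.ofPred_and]
  refine isClosed_iInter fun e => IsClosed.inter ?_ (isClosed_iInter fun i => IsClosed.inter ?_ ?_)
  · exact isClosed_eq (by fun_prop) continuous_const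
  · exact isClosed_le continuous_const (by fun_prop)
  · exact isClosed_le (by fun_prop) continuous_const

theorem norm_sub_sq_le_feasibleBound [Nonempty X] {Ψ : PairwiseMRF G X} {x y : Messages G X}
    (hx : x ∈ Ψ.feasible) (hy : y ∈ Ψ.feasible) : ‖x - y‖ ^ 2 ≤ Ψ.feasibleBound := by
  rw [EuclideanSpace.norm_sq_eq, Fintype.sum_prod_type, feasibleBound, Finset.mul_sum]
  refine Finset.sum_le_sum fun e _ => ?_
  set M := Finset.univ.sup' Finset.univ_nonempty fun i => Ψ.rowMax e i
  have hM : ∀ i, Ψ.rowMax e i ≤ M := fun i =>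
    Finset.le_sup' (fun i => Ψ.rowMax e i) (Finset.mem_univ i)
  -- For `0 ≤ x, y ≤ M` one has `(x - y)² ≤ x² + y² ≤ M (x + y)`; normalization then gives `2 M` per
  -- edge, whatever the number of states.
  calc ∑ i, ‖(x - y) (e, i)‖ ^ 2 ≤ ∑ i, M * (x (e, i) + y (e, i)) := by
        refine Finset.sum_le_sum fun i _ => ?_
        rw [Real.norm_eq_abs, sq_abs]
        show (x (e, i) - y (e, i)) ^ 2 ≤ _
        have x0 := (pos_of_mem_feasible hx (e, i)).le
        have y0 := (pos_of_mem_feasible hy (e, i)).le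
        have x1 := ((hx e).2 i).2.trans (hM i)
        have y1 := ((hy e).2 i).2.trans (hM i)
        nlinarith [mul_nonneg x0 y0, mul_nonneg x0 (sub_nonneg.2 x1),
          mul_nonneg y0 (sub_nonneg.2 y1)]
    _ = 2 * M := by
        rw [← Finset.mul_sum, Finset.sum_add_distrib, (hx e).1, (hy e).1]
        ring

theorem sum_min_le_norm_sq [Nonempty X] {Ψ : PairwiseMRF G X} {x : Messages G X}
    (hx : x ∈ Ψ.feasible) :
    ∑ e : G.Dart, (Finset.univ.inf' Finset.univ_nonempty fun i => Ψ.rowMin e i) ≤ ‖x‖ ^ 2 := by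
  rw [EuclideanSpace.norm_sq_eq, Fintype.sum_prod_type]
  refine Finset.sum_le_sum fun e _ => ?_
  set L := Finset.univ.inf' Finset.univ_nonempty fun i => Ψ.rowMin e i
  have hL : ∀ i, L ≤ Ψ.rowMin e i := fun i =>
    Finset.inf'_le (fun i => Ψ.rowMin e i) (Finset.mem_univ i)
  calc L = ∑ i, L * x (e, i) := by rw [← Finset.mul_sum, (hx e).1, mul_one]
    _ ≤ _ := by
      refine Finset.sum_le_sum fun i _ => ?_
      rw [Real.norm_eq_abs, sq_abs, sq]
      exact mul_le_mul_of_nonneg_right ((hL i).trans ((hx e).2 i).1)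
        (pos_of_mem_feasible hx (e, i)).le

theorem feasibleBound_pos [Nonempty X] [Nonempty G.Dart] (Ψ : PairwiseMRF G X) :
    0 < Ψ.feasibleBound := by
  refine mul_pos two_pos (Finset.sum_pos (fun e _ => ?_) Finset.univ_nonempty)
  have i := Classical.arbitrary X
  exact ((Ψ.normCol_pos e i i).trans_le (Ψ.le_rowMax e i i)).trans_le
    (Finset.le_sup' (fun i => Ψ.rowMax e i) (Finset.mem_univ i))

theorem sum_min_pos [Nonempty X] [Nonempty G.Dart] (Ψ : PairwiseMRF G X) :
    0 < ∑ e : G.Dart, (Finset.univ.inf' Finset.univ_nonempty fun i => Ψ.rowMin e i) := by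
  refine Finset.sum_pos (fun e _ => ?_) Finset.univ_nonempty
  rw [Finset.lt_inf'_iff]
  exact fun i _ => Ψ.rowMin_pos e i

/-- `K(ψ) / 2` is the quotient of `feasibleBound` by the sum of the minima, and that sum bounds
`‖x‖²` from below. The main theorem does not need the factor `1 / 2`. -/
theorem feasibleBound_le_prefactor_mul [Nonempty X] [Nonempty G.Dart] {Ψ : PairwiseMRF G X}
    {x : Messages G X} (hx : x ∈ Ψ.feasible) :
    Ψ.feasibleBound ≤ Ψ.prefactor / 2 * ‖x‖ ^ 2 := by
  have h1 := sum_min_le_norm_sq hx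
  have h2 := Ψ.sum_min_pos
  have h3 := Ψ.feasibleBound_pos
  rw [feasibleBound] at h3 ⊢
  rw [prefactor]
  set S := ∑ e : G.Dart, (Finset.univ.inf' Finset.univ_nonempty fun i => Ψ.rowMin e i)
  set U := ∑ e : G.Dart, Finset.univ.sup' Finset.univ_nonempty fun i => Ψ.rowMax e i
  have : 2 * U = 4 * (U / S) / 2 * S := by
    field_simp
    ring
  rw [this]
  refine mul_le_mul_of_nonneg_left h1 ?_
  have : 0 < U := by linarith
  positivity

theorem isMessage_of_mem_feasible [Nonempty X] {Ψ : PairwiseMRF G X} {m : Messages G X}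
    (hm : m ∈ Ψ.feasible) : IsMessage m := fun e =>
  ⟨fun i => (pos_of_mem_feasible hm (e, i)).le, (hm e).1⟩

/-- A vanishing normalizer would, since division by zero gives zero, make the whole message on that
edge zero, contrary to its sum being one. -/
theorem IsBPFixedPoint.mem_feasible [Nonempty X] {Ψ : PairwiseMRF G X} {m : Messages G X}
    (hm : Ψ.IsBPFixedPoint m) : m ∈ Ψ.feasible := by
  rw [← hm.2]
  refine Ψ.bpUpdate_mem_feasible (fun e j => incoming_nonneg (fun p => (hm.1 p.1).1 p.2) e j)
    fun e he => ?_
  have h1 := (hm.1 e).2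
  have h2 : ∀ i, m (e, i) = 0 := fun i => by
    rw [← hm.2, bpUpdate_apply, sum_bpUnnormalized, he, div_zero]
  simp [h2] at h1

theorem IsContractive.eq_of_fixed [Nonempty X] {Ψ : PairwiseMRF G X} {η : ℝ} (hη : 0 < η)
    (hF : Ψ.IsContractive η) {x y : Messages G X} (hx : Ψ.IsBPFixedPoint x)
    (hy : Ψ.IsBPFixedPoint y) : x = y := by
  have h := hF x hx.mem_feasible y hy.mem_feasible
  rw [hx.2, hy.2] at h
  have h0 : ‖x - y‖ ≤ 0 := by
    by_contra hc
    push Not at hc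
    nlinarith
  exact sub_eq_zero.1 (norm_le_zero_iff.1 h0)

theorem IsContractive.exists_fixed [Nonempty X] {Ψ : PairwiseMRF G X} {η : ℝ} (hη : 0 < η)
    (hη2 : η < 2) (hF : Ψ.IsContractive η) : ∃ x, Ψ.IsBPFixedPoint x := by
  have hmaps : Set.MapsTo Ψ.bpUpdate Ψ.feasible Ψ.feasible := fun x hx =>
    Ψ.bpUpdate_mem_feasible_of_pos (pos_of_mem_feasible hx)
  have hlip : LipschitzOnWith (1 - η / 2).toNNReal Ψ.bpUpdate Ψ.feasible := by
    refine LipschitzOnWith.of_dist_le_mul fun x hx y hy => ?_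
    rw [dist_eq_norm, dist_eq_norm, Real.coe_toNNReal _ (by linarith)]
    exact hF x hx y hy
  have hc : ContractingWith (1 - η / 2).toNNReal (hmaps.restrict Ψ.bpUpdate _ _) := by
    refine ⟨?_, hlip.mapsToRestrict hmaps⟩
    rw [Real.toNNReal_lt_one]
    linarith
  obtain ⟨y, hy, hfix, -⟩ := ContractingWith.exists_fixedPoint' Ψ.isClosed_feasible.isComplete hmaps hc
    (Ψ.sampledColumn_mem_feasible fun _ => Classical.arbitrary X) (edist_ne_top _ _)
  exact ⟨y, isMessage_of_mem_feasible hy, hfix⟩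

theorem contDiff_incoming (e : G.Dart) (j : X) {n : WithTop ℕ∞} :
    ContDiff ℝ n fun m : Messages G X => incoming m e j := by
  unfold incoming
  fun_prop

theorem contDiff_bpUnnormalized (Ψ : PairwiseMRF G X) (e : G.Dart) (i : X) {n : WithTop ℕ∞} :
    ContDiff ℝ n fun m : Messages G X => Ψ.bpUnnormalized m e i := by
  unfold bpUnnormalized
  exact ContDiff.sum fun j _ => contDiff_const.mul (contDiff_incoming e j)

theorem contDiffOn_bpUpdate [Nonempty X] (Ψ : PairwiseMRF G X) {n : WithTop ℕ∞} :
    ContDiffOn ℝ n Ψ.bpUpdate {m : Messages G X | ∀ p, 0 < m p} := by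
  rw [contDiffOn_euclidean]
  rintro ⟨e, i⟩
  refine ContDiffOn.div (Ψ.contDiff_bpUnnormalized e i).contDiffOn
    (ContDiff.sum fun k _ => Ψ.contDiff_bpUnnormalized e k).contDiffOn fun m hm => ?_
  show ∑ k, Ψ.bpUnnormalized m e k ≠ 0
  rw [sum_bpUnnormalized]
  exact (Ψ.sum_incoming_mul_colSum_pos hm e).ne'

/-- A `C¹` map is Lipschitz on a compact convex set. This replaces the contraction hypothesis at
positive messages that need not be feasible. -/
theorem exists_lipschitzOnWith_bpUpdate [Nonempty X] (Ψ : PairwiseMRF G X) {c : ℝ} (hc : 0 < c)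
    (R : ℝ) : ∃ K, LipschitzOnWith K Ψ.bpUpdate
      ({m : Messages G X | ∀ p, c ≤ m p} ∩ Metric.closedBall 0 R) := by
  refine ContDiffOn.exists_lipschitzOnWith (n := 1)
    (Ψ.contDiffOn_bpUpdate.mono fun m hm p => hc.trans_le (hm.1 p)) one_ne_zero ?_ ?_
  · refine Convex.inter ?_ (convex_closedBall _ _)
    intro x hx y hy a b ha hb hab p
    show c ≤ a * x p + b * y p
    have h1 := mul_le_mul_of_nonneg_left (hx p) ha
    have h2 := mul_le_mul_of_nonneg_left (hy p) hb
    calc c = (a + b) * c := by rw [hab, one_mul]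
      _ ≤ _ := by linarith
  · refine (isCompact_closedBall _ _).inter_left ?_
    simp only [Set.ofPred_forall]
    exact isClosed_iInter fun p => isClosed_le continuous_const (by fun_prop)

theorem measurable_bpUpdate (Ψ : PairwiseMRF G X) : Measurable Ψ.bpUpdate := by
  refine (MeasurableEquiv.toLp 2 (G.Dart × X → ℝ)).measurable.comp (measurable_pi_lambda _ ?_)
  rintro ⟨e, i⟩
  exact (Ψ.contDiff_bpUnnormalized e i (n := 1)).continuous.measurable.div
    (Finset.measurable_sum _ fun k _ =>
      (Ψ.contDiff_bpUnnormalized e k (n := 1)).continuous.measurable)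

end PairwiseMRF
end

/-! ### The noise and the one-step estimates for SBP -/

noncomputable section

namespace PairwiseMRF

variable {V X : Type*} [Fintype V] [DecidableEq V] [Fintype X]
  {G : SimpleGraph V} [DecidableRel G.Adj]

section Iteration

variable [Nonempty X] {Ω : Type*} [mΩ : MeasurableSpace Ω] {Ψ : PairwiseMRF G X} {α : ℕ → ℝ}
  {m₀ : Messages G X} {μ : Measure Ω} [IsProbabilityMeasure μ] {ℱ : Filtration ℕ mΩ}
  {m : ℕ → Ω → Messages G X} {J : ℕ → Ω → G.Dart → X}

theorem abs_apply_le_one {x : Messages G X} (hx : x ∈ Ψ.feasible) (p : G.Dart × X) :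
    |x p| ≤ 1 := by
  rw [abs_of_pos (pos_of_mem_feasible hx p), ← (hx p.1).1]
  exact Finset.single_le_sum (f := fun i => x (p.1, i))
    (fun i _ => (pos_of_mem_feasible hx (p.1, i)).le) (Finset.mem_univ p.2)

theorem norm_sub_le_sqrt_feasibleBound {x y : Messages G X}
    (hx : x ∈ Ψ.feasible) (hy : y ∈ Ψ.feasible) : ‖x - y‖ ≤ √Ψ.feasibleBound :=
  Real.le_sqrt_of_sq_le (norm_sub_sq_le_feasibleBound hx hy)

/-- Writing a coordinate through indicators of the index lets the conditional law of the index
determine its conditional mean. -/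
theorem sampledColumn_eq_sum (Ψ : PairwiseMRF G X) (x : Ω → G.Dart → X) (e : G.Dart) (i : X) :
    (fun ω => Ψ.sampledColumn (x ω) (e, i)) =
      ∑ j, Ψ.normCol e i j • Set.indicator {ω | x ω e = j} (fun _ => (1 : ℝ)) := by
  classical
  ext ω
  simp [sampledColumn_apply, Finset.sum_apply, Set.indicator_apply]

namespace IsSBP

theorem update_eq (h : Ψ.IsSBP α m₀ μ ℱ m J) (t : ℕ) (ω : Ω) :
    m (t + 1) ω = (1 - α t) • m t ω + α t • Ψ.sampledColumn (J (t + 1) ω) := by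
  ext ⟨e, i⟩
  exact h.update t ω e i

theorem measurable_sampledColumn (h : Ψ.IsSBP α m₀ μ ℱ m J) (t : ℕ) (p : G.Dart × X) :
    Measurable fun ω => Ψ.sampledColumn (J (t + 1) ω) p := by
  obtain ⟨e, i⟩ := p
  rw [sampledColumn_eq_sum]
  have hj : ∀ j, Measurable (Ψ.normCol e i j •
      Set.indicator {ω | J (t + 1) ω e = j} (fun _ => (1 : ℝ))) := fun j =>
    (measurable_const.indicator (h.measurable_index t e j)).const_smul (Ψ.normCol e i j)
  convert Finset.measurable_sum Finset.univ fun j _ => hj j using 1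
  ext ω
  rw [Finset.sum_apply]

theorem integrable_sampledColumn (h : Ψ.IsSBP α m₀ μ ℱ m J) (t : ℕ) (p : G.Dart × X) :
    Integrable (fun ω => Ψ.sampledColumn (J (t + 1) ω) p) μ :=
  .of_bound (h.measurable_sampledColumn t p).aestronglyMeasurable 1
    (.of_forall fun _ => abs_apply_le_one (Ψ.sampledColumn_mem_feasible _) p)

theorem condExp_sampledColumn (h : Ψ.IsSBP α m₀ μ ℱ m J) (t : ℕ) (p : G.Dart × X) :
    μ[fun ω => Ψ.sampledColumn (J (t + 1) ω) p | ℱ t] =ᵐ[μ] fun ω => Ψ.bpUpdate (m t ω) p := by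
  obtain ⟨e, i⟩ := p
  rw [sampledColumn_eq_sum]
  have hint : ∀ j, Integrable (Set.indicator {ω | J (t + 1) ω e = j} (fun _ => (1 : ℝ))) μ :=
    fun j => (integrable_const _).indicator (h.measurable_index t e j)
  have h1 := condExp_finsetSum (μ := μ) (s := Finset.univ)
    (f := fun j => Ψ.normCol e i j • Set.indicator {ω | J (t + 1) ω e = j} (fun _ => (1 : ℝ)))
    (fun j _ => (hint j).smul _) (ℱ t)
  have h2 : ∀ᵐ ω ∂μ, ∀ j, (μ[Ψ.normCol e i j •
      Set.indicator {ω | J (t + 1) ω e = j} (fun _ => (1 : ℝ)) | ℱ t]) ω =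
      Ψ.normCol e i j * Ψ.sampleProb (m t ω) e j := by
    refine ae_all_iff.2 fun j => ?_
    filter_upwards [condExp_smul (μ := μ) (Ψ.normCol e i j)
      (Set.indicator {ω | J (t + 1) ω e = j} (fun _ => (1 : ℝ))) (ℱ t),
      h.condProb_index t e j] with ω h3 h4
    rw [h3, Pi.smul_apply, h4, smul_eq_mul]
  filter_upwards [h1, h2] with ω h3 h4
  rw [h3, Finset.sum_apply, bpUpdate_eq_sum_sampleProb]
  exact Finset.sum_congr rfl fun j _ => h4 j

theorem measurable_bpUpdate_comp (h : Ψ.IsSBP α m₀ μ ℱ m J) (t : ℕ) :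
    StronglyMeasurable[ℱ t] fun ω => Ψ.bpUpdate (m t ω) :=
  (Ψ.measurable_bpUpdate.comp (h.adapted t).measurable).stronglyMeasurable

/-- The sampling noise is conditionally orthogonal to every bounded vector known at time `t`. -/
theorem condExp_inner_noise (h : Ψ.IsSBP α m₀ μ ℱ m J) (hpos : ∀ t ω p, 0 < m t ω p) (t : ℕ)
    {D : Ω → Messages G X} (hD : StronglyMeasurable[ℱ t] D) {R : ℝ} (hR : ∀ ω, ‖D ω‖ ≤ R) :
    μ[fun ω => inner ℝ (D ω) (Ψ.sampledColumn (J (t + 1) ω) - Ψ.bpUpdate (m t ω)) | ℱ t]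
      =ᵐ[μ] 0 := by
  -- The inner product is linear in the noise, so it suffices to treat single coordinates. This is
  -- why only the marginal conditional law on each edge matters.
  set f : G.Dart × X → Ω → ℝ := fun p ω =>
    Ψ.sampledColumn (J (t + 1) ω) p - Ψ.bpUpdate (m t ω) p with hf
  have hcoord : ∀ p, StronglyMeasurable[ℱ t] fun ω => Ψ.bpUpdate (m t ω) p := fun p =>
    (EuclideanSpace.proj (𝕜 := ℝ) p).continuous.comp_stronglyMeasurable
      (h.measurable_bpUpdate_comp t)
  have hDp : ∀ p, StronglyMeasurable[ℱ t] fun ω => D ω p := fun p =>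
    (EuclideanSpace.proj (𝕜 := ℝ) p).continuous.comp_stronglyMeasurable hD
  have hB : ∀ p, Integrable (fun ω => Ψ.bpUpdate (m t ω) p) μ := fun p =>
    .of_bound ((hcoord p).mono (ℱ.le t)).aestronglyMeasurable 1
      (.of_forall fun ω => abs_apply_le_one (Ψ.bpUpdate_mem_feasible_of_pos (hpos t ω)) p)
  have hfint : ∀ p, Integrable (f p) μ := fun p => (h.integrable_sampledColumn t p).sub (hB p)
  have hDb : ∀ p ω, ‖D ω p‖ ≤ R := fun p ω => (PiLp.norm_apply_le _ p).trans (hR ω)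
  have hzero : ∀ p, μ[(fun ω => D ω p) * f p | ℱ t] =ᵐ[μ] 0 := fun p => by
    filter_upwards [condExp_stronglyMeasurable_mul_of_bound (ℱ.le t) (hDp p) (hfint p) R
      (.of_forall (hDb p)), condExp_sub (h.integrable_sampledColumn t p) (hB p) (ℱ t),
      h.condExp_sampledColumn t p] with ω h1 h2 h3
    have h4 : (μ[f p | ℱ t]) ω = 0 := by
      have h5 : (μ[f p | ℱ t]) ω = _ := h2
      rw [h5, Pi.sub_apply, h3, condExp_of_stronglyMeasurable (ℱ.le t) (hcoord p) (hB p), sub_self]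
    rw [h1, Pi.mul_apply, h4, mul_zero]
    rfl
  have hsum : (fun ω => inner ℝ (D ω) (Ψ.sampledColumn (J (t + 1) ω) - Ψ.bpUpdate (m t ω))) =
      ∑ p, (fun ω => D ω p) * f p := by
    ext ω
    rw [PiLp.inner_apply, Finset.sum_apply]
    refine Finset.sum_congr rfl fun p _ => ?_
    simp [hf, mul_comm]
  rw [hsum]
  have h1 := condExp_finsetSum (μ := μ) (s := Finset.univ) (f := fun p => (fun ω => D ω p) * f p)
    (fun p _ => (hfint p).bdd_mul ((hDp p).mono (ℱ.le t)).aestronglyMeasurable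
      (.of_forall (hDb p))) (ℱ t)
  filter_upwards [h1, ae_all_iff.2 hzero] with ω h2 h3
  rw [h2, Finset.sum_apply]
  exact Finset.sum_eq_zero fun p _ => h3 p

end IsSBP

/-- The sampling noise in direction of the deviation from `z`, where the current message is corrected
by a deterministic vector `w t`, with weights `γ`. -/
def noise (Ψ : PairwiseMRF G X) (m : ℕ → Ω → Messages G X) (J : ℕ → Ω → G.Dart → X)
    (w : ℕ → Messages G X) (z : Messages G X) (γ : ℕ → ℝ) (t : ℕ) (ω : Ω) : ℝ :=
  γ t * inner ℝ (m t ω - w t - z) (Ψ.sampledColumn (J (t + 1) ω) - Ψ.bpUpdate (m t ω))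

variable {w : ℕ → Messages G X} {z : Messages G X} {γ : ℕ → ℝ}

/-- The factor `‖m t ω - w t - z‖` is kept because the variance estimate in (c) exploits its decay.
-/
theorem abs_noise_le (hpos : ∀ t ω p, 0 < m t ω p) (hγ : ∀ t, 0 ≤ γ t) (t : ℕ) (ω : Ω) :
    ‖Ψ.noise m J w z γ t ω‖ ≤ γ t * (‖m t ω - w t - z‖ * √Ψ.feasibleBound) := by
  rw [noise, norm_mul, Real.norm_of_nonneg (hγ t)]
  refine mul_le_mul_of_nonneg_left ((norm_inner_le_norm _ _).trans ?_) (hγ t)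
  exact mul_le_mul_of_nonneg_left (norm_sub_le_sqrt_feasibleBound
    (Ψ.sampledColumn_mem_feasible _) (Ψ.bpUpdate_mem_feasible_of_pos (hpos t ω))) (norm_nonneg _)

theorem feasibleBound_nonneg (hz : z ∈ Ψ.feasible) : 0 ≤ Ψ.feasibleBound := by
  have := norm_sub_sq_le_feasibleBound hz hz
  simpa using this

theorem norm_noise_le (hpos : ∀ t ω p, 0 < m t ω p) (hw : ∀ t ω, m t ω - w t ∈ Ψ.feasible)
    (hz : z ∈ Ψ.feasible) (hγ : ∀ t, 0 ≤ γ t) (t : ℕ) (ω : Ω) :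
    ‖Ψ.noise m J w z γ t ω‖ ≤ γ t * Ψ.feasibleBound := by
  refine (abs_noise_le hpos hγ t ω).trans (mul_le_mul_of_nonneg_left ?_ (hγ t))
  calc ‖m t ω - w t - z‖ * √Ψ.feasibleBound ≤ √Ψ.feasibleBound * √Ψ.feasibleBound :=
        mul_le_mul_of_nonneg_right (norm_sub_le_sqrt_feasibleBound (hw t ω) hz) (Real.sqrt_nonneg _)
    _ = Ψ.feasibleBound := Real.mul_self_sqrt (feasibleBound_nonneg hz)

namespace IsSBP

theorem stronglyMeasurable_deviation (h : Ψ.IsSBP α m₀ μ ℱ m J) (t : ℕ) :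
    StronglyMeasurable[ℱ t] fun ω => m t ω - w t - z :=
  ((h.adapted t).sub stronglyMeasurable_const).sub stronglyMeasurable_const

/-- The indices are not assumed adapted to `ℱ`. The sampled column is recovered from two consecutive
messages, dividing by `α t > 0`. -/
theorem stronglyMeasurable_noise (h : Ψ.IsSBP α m₀ μ ℱ m J) (hα : ∀ t, 0 < α t) (t : ℕ) :
    StronglyMeasurable[ℱ (t + 1)] (Ψ.noise m J w z γ t) := by
  have hle : (ℱ t : MeasurableSpace Ω) ≤ ℱ (t + 1) := ℱ.mono t.le_succ
  have h1 : (fun ω => Ψ.sampledColumn (J (t + 1) ω)) =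
      fun ω => (α t)⁻¹ • (m (t + 1) ω - (1 - α t) • m t ω) := by
    ext1 ω
    rw [h.update_eq, add_sub_cancel_left, inv_smul_smul₀ (hα t).ne']
  have h2 : StronglyMeasurable[ℱ (t + 1)] fun ω => Ψ.sampledColumn (J (t + 1) ω) := by
    rw [h1]
    exact ((h.adapted (t + 1)).sub (((h.adapted t).mono hle).const_smul (1 - α t))).const_smul (α t)⁻¹
  exact (((h.stronglyMeasurable_deviation t).mono hle).inner
    (h2.sub ((h.measurable_bpUpdate_comp t).mono hle))).const_mul (γ t)

theorem condExp_noise (h : Ψ.IsSBP α m₀ μ ℱ m J) (hpos : ∀ t ω p, 0 < m t ω p)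
    (hw : ∀ t ω, m t ω - w t ∈ Ψ.feasible) (hz : z ∈ Ψ.feasible) (t : ℕ) :
    μ[Ψ.noise m J w z γ t | ℱ t] =ᵐ[μ] 0 := by
  have h1 := h.condExp_inner_noise hpos t
    ((h.stronglyMeasurable_deviation (w := w) (z := z) t).const_smul (γ t))
    (R := ‖γ t‖ * √Ψ.feasibleBound) fun ω => by
      rw [Pi.smul_apply, norm_smul]
      exact mul_le_mul_of_nonneg_left (norm_sub_le_sqrt_feasibleBound (hw t ω) hz) (norm_nonneg _)
  refine (EventuallyEq.of_eq ?_).trans h1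
  congr 1
  ext ω
  rw [noise, Pi.smul_apply, real_inner_smul_left]

/-- The shift `w` solves the update without its sampling term, so `m - w` is averaged with the same
sampled columns as `m`. The columns are still drawn at `m`, which leaves the difference of two
values of `F`. -/
theorem norm_deviation_sq_le {η : ℝ} (h : Ψ.IsSBP α m₀ μ ℱ m J) (hα : ∀ t, 0 ≤ α t)
    (hF : Ψ.IsContractive η) (hz : Ψ.IsBPFixedPoint z) (hw : ∀ t ω, m t ω - w t ∈ Ψ.feasible)
    (hw' : ∀ t, w (t + 1) = (1 - α t) • w t) (t : ℕ) (ω : Ω) :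
    ‖m (t + 1) ω - w (t + 1) - z‖ ^ 2 ≤ (1 - η * α t) * ‖m t ω - w t - z‖ ^ 2 +
      (2 * Ψ.noise m J w z α t ω + 2 * (α t * (‖m t ω - w t - z‖ *
        ‖Ψ.bpUpdate (m t ω) - Ψ.bpUpdate (m t ω - w t)‖)) + α t ^ 2 * Ψ.feasibleBound) := by
  have e1 : m (t + 1) ω - w (t + 1) =
      (1 - α t) • (m t ω - w t) + α t • Ψ.sampledColumn (J (t + 1) ω) := by
    rw [h.update_eq, hw']
    module
  rw [e1]
  refine (norm_sq_averaging_step_le (F := Ψ.bpUpdate) (x := m t ω) (Ψ.sampledColumn (J (t + 1) ω))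
    (hα t) hz.2 (hF _ (hw t ω) _ hz.mem_feasible)).trans ?_
  have := mul_le_mul_of_nonneg_left (norm_sub_sq_le_feasibleBound (hw t ω)
    (Ψ.sampledColumn_mem_feasible (J (t + 1) ω))) (sq_nonneg (α t))
  rw [noise]
  linarith

theorem mem_feasible (h : Ψ.IsSBP α m₀ μ ℱ m J) (hα : ∀ t, 0 < α t ∧ α t ≤ 1)
    (hm : m₀ ∈ Ψ.feasible) (t : ℕ) (ω : Ω) : m t ω ∈ Ψ.feasible := by
  induction t with
  | zero => rwa [h.init]
  | succ t ih =>
    rw [h.update_eq]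
    exact Ψ.convex_feasible ih (Ψ.sampledColumn_mem_feasible _) (by linarith [(hα t).2])
      (hα t).1.le (by ring)

theorem integrable_norm_sq (h : Ψ.IsSBP α m₀ μ ℱ m J) (hfeas : ∀ t ω, m t ω ∈ Ψ.feasible)
    (hz : z ∈ Ψ.feasible) (t : ℕ) : Integrable (fun ω => ‖m t ω - z‖ ^ 2) μ := by
  refine .of_bound ((((h.adapted t).mono (ℱ.le t)).sub
    stronglyMeasurable_const).norm.pow 2).aestronglyMeasurable Ψ.feasibleBound
    (.of_forall fun ω => ?_)
  rw [Real.norm_of_nonneg (sq_nonneg _)]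
  exact norm_sub_sq_le_feasibleBound (hfeas t ω) hz

theorem integrable_noise (h : Ψ.IsSBP α m₀ μ ℱ m J) (hα : ∀ t, 0 < α t)
    (hpos : ∀ t ω p, 0 < m t ω p) (hw : ∀ t ω, m t ω - w t ∈ Ψ.feasible) (hz : z ∈ Ψ.feasible)
    (hγ : ∀ t, 0 ≤ γ t) (t : ℕ) : Integrable (Ψ.noise m J w z γ t) μ :=
  .of_bound ((h.stronglyMeasurable_noise hα t).mono (ℱ.le _)).aestronglyMeasurable _
    (.of_forall (norm_noise_le hpos hw hz hγ t))

theorem integral_noise (h : Ψ.IsSBP α m₀ μ ℱ m J)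
    (hpos : ∀ t ω p, 0 < m t ω p) (hw : ∀ t ω, m t ω - w t ∈ Ψ.feasible) (hz : z ∈ Ψ.feasible)
    (t : ℕ) : ∫ ω, Ψ.noise m J w z γ t ω ∂μ = 0 := by
  rw [← integral_condExp (ℱ.le t)]
  exact integral_eq_zero_of_ae (h.condExp_noise hpos hw hz t)

/-- One step of the iteration started at a feasible message. -/
theorem norm_sub_sq_succ_le {η : ℝ} (h : Ψ.IsSBP α m₀ μ ℱ m J) (hα : ∀ t, 0 < α t)
    (hF : Ψ.IsContractive η) (hz : Ψ.IsBPFixedPoint z) (hfeas : ∀ t ω, m t ω ∈ Ψ.feasible)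
    (t : ℕ) (ω : Ω) :
    ‖m (t + 1) ω - z‖ ^ 2 ≤ (1 - η * α t) * ‖m t ω - z‖ ^ 2 +
      (2 * Ψ.noise m J (fun _ => 0) z α t ω + α t ^ 2 * Ψ.feasibleBound) := by
  have := h.norm_deviation_sq_le (w := fun _ => 0) (fun t => (hα t).le) hF hz
    (fun t ω => by simpa using hfeas t ω) (fun t => by simp) t ω
  simpa using this

theorem integral_norm_sub_sq_succ_le {η : ℝ} (h : Ψ.IsSBP α m₀ μ ℱ m J) (hα : ∀ t, 0 < α t)
    (hF : Ψ.IsContractive η) (hz : Ψ.IsBPFixedPoint z) (hfeas : ∀ t ω, m t ω ∈ Ψ.feasible)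
    (t : ℕ) :
    ∫ ω, ‖m (t + 1) ω - z‖ ^ 2 ∂μ ≤ (1 - η * α t) * ∫ ω, ‖m t ω - z‖ ^ 2 ∂μ +
      α t ^ 2 * Ψ.feasibleBound := by
  have hpos : ∀ t ω p, 0 < m t ω p := fun t ω p => pos_of_mem_feasible (hfeas t ω) p
  have hw : ∀ t ω, m t ω - (fun _ => 0 : ℕ → Messages G X) t ∈ Ψ.feasible := fun t ω => by
    simpa using hfeas t ω
  have i1 := (h.integrable_norm_sq hfeas hz.mem_feasible t).const_mul (1 - η * α t)
  have i2 := (h.integrable_noise hα hpos hw hz.mem_feasible (fun t => (hα t).le) t).const_mul 2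
  have i3 : Integrable (fun ω => 2 * Ψ.noise m J (fun _ => 0) z α t ω +
      α t ^ 2 * Ψ.feasibleBound) μ := i2.add (integrable_const _)
  refine (integral_mono (h.integrable_norm_sq hfeas hz.mem_feasible (t + 1)) (i1.add i3)
    fun ω => h.norm_sub_sq_succ_le hα hF hz hfeas t ω).trans_eq ?_
  simp only [Pi.add_apply]
  rw [integral_add i1 i3, integral_add i2 (integrable_const _), integral_const_mul,
    integral_const_mul, h.integral_noise hpos hw hz.mem_feasible]
  simp

end IsSBP

end Iteration

end PairwiseMRF
end

/-! ### Almost sure convergence and rates -/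

noncomputable section

theorem exists_pos_forall_le {ι : Type*} [Finite ι] {f : ι → ℝ} (hf : ∀ i, 0 < f i) :
    ∃ c, 0 < c ∧ ∀ i, c ≤ f i := by
  cases isEmpty_or_nonempty ι
  · exact ⟨1, one_pos, fun i => isEmptyElim i⟩
  · obtain ⟨i, hi⟩ := Finite.exists_min f
    exact ⟨f i, hf i, hi⟩

namespace PairwiseMRF

variable {V X : Type*} [Fintype V] [DecidableEq V] [Fintype X]
  {G : SimpleGraph V} [DecidableRel G.Adj]
  [Nonempty X] {Ω : Type*} [mΩ : MeasurableSpace Ω] {Ψ : PairwiseMRF G X} {α : ℕ → ℝ}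
  {m₀ : Messages G X} {μ : Measure Ω} [IsProbabilityMeasure μ] {ℱ : Filtration ℕ mΩ}
  {m : ℕ → Ω → Messages G X} {J : ℕ → Ω → G.Dart → X} {z : Messages G X} {η : ℝ}

namespace IsSBP

theorem ae_tendsto (h : Ψ.IsSBP α m₀ μ ℱ m J) (hη : 0 < η) (hF : Ψ.IsContractive η)
    (hz : Ψ.IsBPFixedPoint z) (hα : ∀ t, 0 < α t ∧ α t ≤ 1)
    (hO : α =O[atTop] (fun t : ℕ => 1 / (t : ℝ))) (hns : ¬ Summable α)
    (hm₀ : ∀ p, 0 < m₀ p) : ∀ᵐ ω ∂μ, Tendsto (fun t => m t ω) atTop (𝓝 z) := by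
  have hzf := hz.mem_feasible
  set C := Ψ.feasibleBound with hC
  have hC0 : 0 ≤ C := feasibleBound_nonneg hzf
  -- the weight of the initial message
  set p : ℕ → ℝ := fun t => ∏ s ∈ Finset.range t, (1 - α s) with hp
  have hps : ∀ t, p (t + 1) = (1 - α t) * p t := fun t => by
    rw [hp]
    simp only
    rw [Finset.prod_range_succ, mul_comm]
  have hp0 : ∀ t, 0 ≤ p t := fun t => Finset.prod_nonneg fun s _ => by linarith [(hα s).2]
  have hp1 : ∀ t, p t ≤ 1 := fun t => Finset.prod_le_one (fun s _ => by linarith [(hα s).2])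
    fun s _ => by linarith [(hα s).1]
  have hplim : Tendsto p atTop (𝓝 0) :=
    tendsto_zero_of_le_one_sub_mul_add (a := α) (e := fun _ => 0) (l := 0) (η := 1) hp0
      (fun t => (hα t).1.le) one_pos hns (by simp) fun t => by rw [hps, one_mul, add_zero]
  -- Since `p 0 = 1`, the shifted trajectory starts at `z`, which is feasible even if `m₀` is not
  -- normalized.
  set w : ℕ → Messages G X := fun t => p t • (m₀ - z) with hw
  have hws : ∀ t, w (t + 1) = (1 - α t) • w t := fun t => by
    simp only [hw]
    rw [hps, mul_smul]
  have hwlim : Tendsto w atTop (𝓝 0) := by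
    simpa using hplim.smul_const (m₀ - z)
  have hwn : ∀ t, ‖w t‖ ≤ ‖m₀ - z‖ := fun t => by
    simp only [hw]
    rw [norm_smul, Real.norm_of_nonneg (hp0 t)]
    exact mul_le_of_le_one_left (norm_nonneg _) (hp1 t)
  have hfeas : ∀ t ω, m t ω - w t ∈ Ψ.feasible := by
    intro t ω
    induction t with
    | zero => simpa [hw, hp, h.init] using hzf
    | succ t ih =>
      have : m (t + 1) ω - w (t + 1) =
          (1 - α t) • (m t ω - w t) + α t • Ψ.sampledColumn (J (t + 1) ω) := by
        rw [h.update_eq, hws]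
        module
      rw [this]
      exact Ψ.convex_feasible ih (Ψ.sampledColumn_mem_feasible _) (by linarith [(hα t).2])
        (hα t).1.le (by ring)
  -- a compact set of positive messages containing the trajectories
  obtain ⟨c, hc0, hc⟩ := exists_pos_forall_le (ι := G.Dart × X)
    (f := fun q => min (m₀ q) (Ψ.rowMin q.1 q.2)) fun q =>
      lt_min (hm₀ q) (Ψ.rowMin_pos q.1 q.2)
  have hcf : ∀ x ∈ Ψ.feasible, ∀ q, c ≤ x q := fun x hx q =>
    ((hc q).trans (min_le_right _ _)).trans ((hx q.1).2 q.2).1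
  have hcm : ∀ t ω q, c ≤ m t ω q := by
    intro t ω q
    induction t with
    | zero =>
      rw [h.init]
      exact (hc q).trans (min_le_left _ _)
    | succ t ih =>
      rw [h.update_eq]
      exact (convex_Ici c) ih (hcf _ (Ψ.sampledColumn_mem_feasible (J (t + 1) ω)) q)
        (by linarith [(hα t).2]) (hα t).1.le (by ring)
  have hpos : ∀ t ω q, 0 < m t ω q := fun t ω q => hc0.trans_le (hcm t ω q)
  have hdev : ∀ t ω, ‖m t ω - w t - z‖ ≤ √C := fun t ω =>
    norm_sub_le_sqrt_feasibleBound (hfeas t ω) hzf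
  have hb : ∀ t ω, ‖m t ω - w t‖ ≤ √C + ‖z‖ := fun t ω => by
    calc ‖m t ω - w t‖ = ‖(m t ω - w t - z) + z‖ := by rw [sub_add_cancel]
      _ ≤ _ := (norm_add_le _ _).trans (by linarith [hdev t ω])
  obtain ⟨K, hK⟩ := Ψ.exists_lipschitzOnWith_bpUpdate hc0 (√C + ‖z‖ + ‖m₀ - z‖)
  have hlip : ∀ t ω, ‖Ψ.bpUpdate (m t ω) - Ψ.bpUpdate (m t ω - w t)‖ ≤ K * (p t * ‖m₀ - z‖) := by
    intro t ω
    have h1 := hK.norm_sub_le (x := m t ω) (y := m t ω - w t)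
      ⟨hcm t ω, by
        rw [mem_closedBall_zero_iff]
        calc ‖m t ω‖ = ‖(m t ω - w t) + w t‖ := by rw [sub_add_cancel]
          _ ≤ _ := (norm_add_le _ _).trans (add_le_add (hb t ω) (hwn t))⟩
      ⟨hcf _ (hfeas t ω), by
        rw [mem_closedBall_zero_iff]
        linarith [hb t ω, norm_nonneg (m₀ - z)]⟩
    rw [sub_sub_cancel] at h1
    refine h1.trans_eq ?_
    simp only [hw]
    rw [norm_smul, Real.norm_of_nonneg (hp0 t)]
  -- summability of the error terms
  have hα2 : Summable fun t => α t ^ 2 := by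
    refine summable_of_isBigO_nat (g := fun t : ℕ => 1 / (t : ℝ) ^ 2)
      (Real.summable_one_div_nat_pow.2 one_lt_two) ?_
    simpa [one_div] using hO.pow 2
  -- Telescoping: `α t * p t = p t - p (t + 1)`.
  have hαp : Summable fun t => α t * p t := by
    refine summable_of_sum_range_le (c := 1) (fun t => mul_nonneg (hα t).1.le (hp0 t)) fun n => ?_
    have : ∑ t ∈ Finset.range n, α t * p t = p 0 - p n := by
      rw [← Finset.sum_range_sub']
      refine Finset.sum_congr rfl fun t _ => ?_
      rw [hps]
      ring
    rw [this]
    have : p 0 = 1 := by simp [hp]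
    linarith [hp0 n]
  have hmart := ae_exists_tendsto_sum_range (μ := μ) (ℱ := ℱ)
    (ξ := fun t => Ψ.noise m J w z α t) (c := fun t => α t * C)
    (h.stronglyMeasurable_noise fun t => (hα t).1)
    (norm_noise_le hpos hfeas hzf fun t => (hα t).1.le)
    (h.condExp_noise hpos hfeas hzf)
    (by simpa only [mul_pow] using hα2.mul_right (C ^ 2))
  filter_upwards [hmart] with ω hω
  obtain ⟨l, hl⟩ := hω
  have hsum : Summable fun t =>
      2 * √C * K * ‖m₀ - z‖ * (α t * p t) + α t ^ 2 * C :=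
    (hαp.mul_left _).add (hα2.mul_right C)
  have herr := (hl.const_mul 2).add hsum.hasSum.tendsto_sum_nat
  have hZ : Tendsto (fun t => ‖m t ω - w t - z‖ ^ 2) atTop (𝓝 0) := by
    refine tendsto_zero_of_le_one_sub_mul_add (a := α)
      (e := fun t => 2 * Ψ.noise m J w z α t ω +
        (2 * √C * K * ‖m₀ - z‖ * (α t * p t) + α t ^ 2 * C)) (fun t => sq_nonneg _)
      (fun t => (hα t).1.le) hη hns (herr.congr fun n => ?_) fun t => ?_
    · rw [Finset.sum_add_distrib (f := fun t => 2 * Ψ.noise m J w z α t ω), Finset.mul_sum]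
    · refine (h.norm_deviation_sq_le (fun t => (hα t).1.le) hF hz hfeas hws t ω).trans ?_
      have h1 : ‖m t ω - w t - z‖ * ‖Ψ.bpUpdate (m t ω) - Ψ.bpUpdate (m t ω - w t)‖ ≤
          √C * (K * (p t * ‖m₀ - z‖)) :=
        mul_le_mul (hdev t ω) (hlip t ω) (norm_nonneg _) (Real.sqrt_nonneg _)
      have h2 := mul_le_mul_of_nonneg_left h1 (hα t).1.le
      linarith
  have hd : Tendsto (fun t => m t ω - w t - z) atTop (𝓝 0) := by
    rw [tendsto_zero_iff_norm_tendsto_zero]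
    have := hZ.sqrt
    simpa using this
  have := (hd.add hwlim).add_const z
  simp only [add_zero, zero_add] at this
  refine this.congr fun t => ?_
  abel

theorem integral_norm_sub_sq_le_of_div_add_two {β : ℝ} (hη : 0 < η) (hF : Ψ.IsContractive η)
    (hz : Ψ.IsBPFixedPoint z) (hβ1 : 1 < β) (hβ2 : β < 2) (hβη : β ≤ 2 * η)
    (hm₀ : m₀ ∈ Ψ.feasible)
    (h : Ψ.IsSBP (fun t => β / (η * ((t : ℝ) + 2))) m₀ μ ℱ m J) (t : ℕ) :
    ∫ ω, ‖m t ω - z‖ ^ 2 ∂μ ≤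
      β ^ 2 * Ψ.feasibleBound / η ^ 2 / (β - 1) / ((t : ℝ) + 1) +
        ‖m₀ - z‖ ^ 2 * (2 / ((t : ℝ) + 2)) ^ β := by
  have hα : ∀ t : ℕ, 0 < β / (η * ((t : ℝ) + 2)) ∧ β / (η * ((t : ℝ) + 2)) ≤ 1 := fun t => by
    have ht : (0 : ℝ) ≤ t := Nat.cast_nonneg t
    refine ⟨by positivity, ?_⟩
    rw [div_le_one (by positivity)]
    nlinarith
  have hC := feasibleBound_nonneg hz.mem_feasible
  have h0 : ∫ ω, ‖m 0 ω - z‖ ^ 2 ∂μ = ‖m₀ - z‖ ^ 2 := by simp [h.init]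
  have key := le_of_recursion_div_add_two (a := fun t => ∫ ω, ‖m t ω - z‖ ^ 2 ∂μ)
    (D := β ^ 2 * Ψ.feasibleBound / η ^ 2) hβ1 hβ2 (by positivity)
    (by rw [h0]; positivity) (fun t => by
      refine (h.integral_norm_sub_sq_succ_le (fun t => (hα t).1) hF hz
        (h.mem_feasible hα hm₀) t).trans_eq ?_
      have ht : (t : ℝ) + 2 ≠ 0 := by positivity
      field_simp) t
  simpa only [h0] using key

/-- Multiplying the one-step inequality by `t + 1` turns the contraction factor into `t`, because `η
α t = 1 / (t + 1)`. The noise enters with constant weight, and the squared steps leave a harmonic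
sum. -/
theorem mul_norm_sub_sq_le_of_div_add_one (hη : 1 ≤ η) (hF : Ψ.IsContractive η)
    (hz : Ψ.IsBPFixedPoint z) (hfeas : ∀ t ω, m t ω ∈ Ψ.feasible)
    (h : Ψ.IsSBP (fun t => 1 / (η * ((t : ℝ) + 1))) m₀ μ ℱ m J) (t : ℕ) (ω : Ω) :
    t * ‖m t ω - z‖ ^ 2 ≤
      2 / η * ∑ s ∈ Finset.range t, Ψ.noise m J (fun _ => 0) z (fun _ => 1) s ω +
      Ψ.feasibleBound / η ^ 2 * (1 + Real.log t) := by
  have hη0 : 0 < η := by linarith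
  have hC := feasibleBound_nonneg hz.mem_feasible
  suffices t * ‖m t ω - z‖ ^ 2 ≤
      2 / η * ∑ s ∈ Finset.range t, Ψ.noise m J (fun _ => 0) z (fun _ => 1) s ω +
      Ψ.feasibleBound / η ^ 2 * ∑ s ∈ Finset.range t, 1 / ((s : ℝ) + 1) from
    this.trans (by gcongr; exact sum_range_one_div_succ_le t)
  induction t with
  | zero => simp
  | succ t ih =>
    have h1 := h.norm_sub_sq_succ_le (fun t => by positivity) hF hz hfeas t ω
    have ht : (0 : ℝ) < (t : ℝ) + 1 := by positivity
    have h2 := mul_le_mul_of_nonneg_left h1 ht.le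
    have h3 : ((t : ℝ) + 1) * ((1 - η * (1 / (η * ((t : ℝ) + 1)))) * ‖m t ω - z‖ ^ 2 +
        (2 * Ψ.noise m J (fun _ => 0) z (fun t => 1 / (η * ((t : ℝ) + 1))) t ω +
          (1 / (η * ((t : ℝ) + 1))) ^ 2 * Ψ.feasibleBound)) =
        t * ‖m t ω - z‖ ^ 2 + 2 / η * Ψ.noise m J (fun _ => 0) z (fun _ => 1) t ω +
          Ψ.feasibleBound / η ^ 2 * (1 / ((t : ℝ) + 1)) := by
      rw [noise, noise]
      field_simp
      ring
    rw [h3] at h2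
    rw [Finset.sum_range_succ, Finset.sum_range_succ]
    push_cast
    linarith

theorem mul_integral_norm_sub_sq_le_of_div_add_one (hη : 1 ≤ η) (hF : Ψ.IsContractive η)
    (hz : Ψ.IsBPFixedPoint z) (hfeas : ∀ t ω, m t ω ∈ Ψ.feasible)
    (h : Ψ.IsSBP (fun t => 1 / (η * ((t : ℝ) + 1))) m₀ μ ℱ m J) (t : ℕ) :
    t * ∫ ω, ‖m t ω - z‖ ^ 2 ∂μ ≤ Ψ.feasibleBound / η ^ 2 * (1 + Real.log t) := by
  have hw : ∀ t ω, m t ω - (fun _ => 0 : ℕ → Messages G X) t ∈ Ψ.feasible := fun t ω => by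
    simpa using hfeas t ω
  have hpos : ∀ t ω p, 0 < m t ω p := fun t ω p => pos_of_mem_feasible (hfeas t ω) p
  have hint : ∀ s, Integrable (Ψ.noise m J (fun _ => 0) z (fun _ => 1) s) μ :=
    h.integrable_noise (fun t => by positivity) hpos hw hz.mem_feasible fun _ => zero_le_one
  have i1 := (integrable_finsetSum (Finset.range t) fun s _ => hint s).const_mul (2 / η)
  rw [← integral_const_mul]
  refine (integral_mono ((h.integrable_norm_sq hfeas hz.mem_feasible t).const_mul _)
    (i1.add (integrable_const (Ψ.feasibleBound / η ^ 2 * (1 + Real.log t))))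
    fun ω => h.mul_norm_sub_sq_le_of_div_add_one hη hF hz hfeas t ω).trans_eq ?_
  simp only [Pi.add_apply]
  rw [integral_add i1 (integrable_const _), integral_const_mul,
    integral_finsetSum _ fun s _ => hint s,
    Finset.sum_eq_zero fun s _ => h.integral_noise hpos hw hz.mem_feasible s]
  simp

/-- By orthogonality the second moment is a sum of variances, each at most `C` times a mean-squared
error. Inserting the mean bound of order `log t / t` and summing the harmonic series gives order
`log² t`. -/
theorem integral_sum_noise_sq_le (hη : 1 ≤ η) (hη2 : η < 2) (hF : Ψ.IsContractive η)
    (hz : Ψ.IsBPFixedPoint z) (hfeas : ∀ t ω, m t ω ∈ Ψ.feasible)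
    (h : Ψ.IsSBP (fun t => 1 / (η * ((t : ℝ) + 1))) m₀ μ ℱ m J) {t : ℕ} (ht : 1 ≤ t) :
    ∫ ω, (∑ s ∈ Finset.range t, Ψ.noise m J (fun _ => 0) z (fun _ => 1) s ω) ^ 2 ∂μ ≤
      5 * (Ψ.feasibleBound * (1 + Real.log t) / η) ^ 2 := by
  have hw : ∀ t ω, m t ω - (fun _ => 0 : ℕ → Messages G X) t ∈ Ψ.feasible := fun t ω => by
    simpa using hfeas t ω
  have hpos : ∀ t ω p, 0 < m t ω p := fun t ω p => pos_of_mem_feasible (hfeas t ω) p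
  have hzf := hz.mem_feasible
  set C := Ψ.feasibleBound
  have hC : 0 ≤ C := feasibleBound_nonneg hzf
  have hη0 : 0 < η := by linarith
  have hα : ∀ t : ℕ, 0 < 1 / (η * ((t : ℝ) + 1)) := fun t => by positivity
  rw [integral_sum_range_sq (h.stronglyMeasurable_noise hα)
    (norm_noise_le hpos hw hzf fun _ => zero_le_one) (h.condExp_noise hpos hw hzf)]
  have hstep : ∀ s, ∫ ω, Ψ.noise m J (fun _ => 0) z (fun _ => 1) s ω ^ 2 ∂μ ≤
      C * ∫ ω, ‖m s ω - z‖ ^ 2 ∂μ := fun s => by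
    rw [← integral_const_mul]
    refine integral_mono_of_nonneg (.of_forall fun ω => sq_nonneg _)
      ((h.integrable_norm_sq hfeas hzf s).const_mul C) (.of_forall fun ω => ?_)
    have h1 := abs_noise_le (Ψ := Ψ) (J := J) (w := fun _ => 0) (z := z) hpos
      (fun _ => zero_le_one : ∀ t : ℕ, (0 : ℝ) ≤ (fun _ => 1) t) s ω
    have h2 := pow_le_pow_left₀ (norm_nonneg _) h1 2
    rw [Real.norm_eq_abs, sq_abs, one_mul, sub_zero, mul_pow, Real.sq_sqrt hC] at h2
    show _ ≤ C * ‖m s ω - z‖ ^ 2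
    linarith
  obtain ⟨n, rfl⟩ : ∃ n, t = n + 1 := ⟨t - 1, by omega⟩
  have hn1 : (1 : ℝ) ≤ ((n + 1 : ℕ) : ℝ) := by exact_mod_cast ht
  set ℓ := 1 + Real.log ((n + 1 : ℕ) : ℝ) with hℓ
  have hℓ1 : 1 ≤ ℓ := by linarith [Real.log_nonneg hn1]
  -- The mean bound carries a factor `t` and says nothing at time zero, so that term is bounded by
  -- `C`.
  have h0 : ∫ ω, ‖m 0 ω - z‖ ^ 2 ∂μ ≤ C := by
    refine (integral_mono (h.integrable_norm_sq hfeas hzf 0) (integrable_const C)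
      fun ω => norm_sub_sq_le_feasibleBound (hfeas 0 ω) hzf).trans_eq ?_
    simp
  have hs : ∀ s ∈ Finset.range n, ∫ ω, ‖m (s + 1) ω - z‖ ^ 2 ∂μ ≤
      C / η ^ 2 * ℓ * (1 / ((s : ℝ) + 1)) := fun s hs => by
    have h1 := h.mul_integral_norm_sub_sq_le_of_div_add_one hη hF hz hfeas (s + 1)
    have h2 : Real.log ((s + 1 : ℕ) : ℝ) ≤ Real.log ((n + 1 : ℕ) : ℝ) := by
      refine Real.log_le_log (by positivity) ?_
      have := Finset.mem_range.1 hs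
      exact_mod_cast (by omega : s + 1 ≤ n + 1)
    have h3 : C / η ^ 2 * (1 + Real.log ((s + 1 : ℕ) : ℝ)) ≤ C / η ^ 2 * ℓ :=
      mul_le_mul_of_nonneg_left (by linarith) (by positivity)
    rw [mul_one_div, le_div_iff₀ (by positivity), mul_comm]
    refine le_trans ?_ (h1.trans h3)
    push_cast
    exact le_rfl
  have hlogn : ∑ s ∈ Finset.range n, 1 / ((s : ℝ) + 1) ≤ ℓ := by
    refine le_trans ?_ (sum_range_one_div_succ_le (n + 1))
    exact Finset.sum_le_sum_of_subset_of_nonneg (Finset.range_subset_range.2 n.le_succ)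
      fun s _ _ => by positivity
  calc ∑ s ∈ Finset.range (n + 1), ∫ ω, Ψ.noise m J (fun _ => 0) z (fun _ => 1) s ω ^ 2 ∂μ
      ≤ ∑ s ∈ Finset.range (n + 1), C * ∫ ω, ‖m s ω - z‖ ^ 2 ∂μ :=
        Finset.sum_le_sum fun s _ => hstep s
    _ = C * (∑ s ∈ Finset.range n, ∫ ω, ‖m (s + 1) ω - z‖ ^ 2 ∂μ +
          ∫ ω, ‖m 0 ω - z‖ ^ 2 ∂μ) := by rw [← Finset.mul_sum, Finset.sum_range_succ']
    _ ≤ C * (∑ s ∈ Finset.range n, C / η ^ 2 * ℓ * (1 / ((s : ℝ) + 1)) + C) := by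
        gcongr with s hs'
        exact hs s hs'
    _ ≤ C * (C / η ^ 2 * ℓ * ℓ + C) := by
        rw [← Finset.mul_sum]
        gcongr
    _ = C ^ 2 / η ^ 2 * (ℓ ^ 2 + η ^ 2) := by
        field_simp
    -- The constant is `5 = 1 + 4`, from `η² < 4` and `1 ≤ ℓ`.
    _ ≤ C ^ 2 / η ^ 2 * (5 * ℓ ^ 2) := by
        gcongr
        nlinarith
    _ = 5 * (C * ℓ / η) ^ 2 := by ring

/-- The high probability bound, from Chebyshev's inequality for the accumulated noise. -/
theorem one_sub_le_measureReal_of_div_add_one [Nonempty G.Dart] (hη : 1 ≤ η) (hη2 : η < 2)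
    (hF : Ψ.IsContractive η) (hz : Ψ.IsBPFixedPoint z) (hfeas : ∀ t ω, m t ω ∈ Ψ.feasible)
    (h : Ψ.IsSBP (fun t => 1 / (η * ((t : ℝ) + 1))) m₀ μ ℱ m J) {ε : ℝ} (hε : 0 < ε)
    {t : ℕ} (ht : 1 ≤ t) :
    1 - ε ≤ μ.real {ω | t * ‖m t ω - z‖ ^ 2 ≤
      Ψ.feasibleBound / η ^ 2 * (1 + 6 / √ε) * (1 + Real.log t)} := by
  have hw : ∀ t ω, m t ω - (fun _ => 0 : ℕ → Messages G X) t ∈ Ψ.feasible := fun t ω => by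
    simpa using hfeas t ω
  have hpos : ∀ t ω p, 0 < m t ω p := fun t ω p => pos_of_mem_feasible (hfeas t ω) p
  have hη0 : 0 < η := by linarith
  have hα : ∀ t : ℕ, 0 < 1 / (η * ((t : ℝ) + 1)) := fun t => by positivity
  have hbound := h.integral_sum_noise_sq_le hη hη2 hF hz hfeas ht
  have hpath := h.mul_norm_sub_sq_le_of_div_add_one hη hF hz hfeas t
  set M : Ω → ℝ := fun ω =>
    ∑ s ∈ Finset.range t, Ψ.noise m J (fun _ => 0) z (fun _ => 1) s ω with hM
  have hMm : StronglyMeasurable M := (stronglyMeasurable_sum_range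
    (h.stronglyMeasurable_noise (w := fun _ => 0) (z := z) (γ := fun _ => 1) hα) t).mono (ℱ.le t)
  have hMb := norm_sum_range_le (norm_noise_le (J := J) hpos hw hz.mem_feasible
    (fun _ => zero_le_one : ∀ t : ℕ, (0 : ℝ) ≤ (fun _ => 1) t)) t
  have hMint : Integrable (fun ω => M ω ^ 2) μ :=
    .of_bound (hMm.pow 2).aestronglyMeasurable _ (.of_forall fun ω => by
      rw [norm_pow]
      exact pow_le_pow_left₀ (norm_nonneg _) (hMb ω) 2)
  set C := Ψ.feasibleBound
  have hC : 0 < C := Ψ.feasibleBound_pos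
  set ℓ := 1 + Real.log (t : ℝ)
  have hℓ1 : 1 ≤ ℓ := by linarith [Real.log_nonneg (Nat.one_le_cast.2 ht : (1 : ℝ) ≤ t)]
  have hsε : 0 < √ε := Real.sqrt_pos.2 hε
  -- Any factor of at least `√5` would do here; `3` leads to `2 / η * r = 6 C ℓ / (η² √ε)`.
  set r := 3 * (C * ℓ / η) / √ε with hr
  have hr0 : 0 < r := by positivity
  have hr2 : ε * r ^ 2 = 9 * (C * ℓ / η) ^ 2 := by
    rw [hr, div_pow, Real.sq_sqrt hε.le]
    field_simp
    ring
  have hcheb := mul_meas_ge_le_integral_of_nonneg (μ := μ)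
    (.of_forall fun ω => sq_nonneg (M ω)) hMint (r ^ 2)
  have hbad : μ.real {ω | r ^ 2 ≤ M ω ^ 2} ≤ ε := by
    have h1 : r ^ 2 * μ.real {ω | r ^ 2 ≤ M ω ^ 2} ≤ r ^ 2 * ε := by
      refine (hcheb.trans hbound).trans ?_
      nlinarith [sq_nonneg (C * ℓ / η)]
    exact le_of_mul_le_mul_left h1 (by positivity)
  have hmeas : MeasurableSet {ω | r ^ 2 ≤ M ω ^ 2} :=
    measurableSet_le measurable_const (hMm.measurable.pow_const 2)
  calc 1 - ε ≤ 1 - μ.real {ω | r ^ 2 ≤ M ω ^ 2} := by linarith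
    _ = μ.real {ω | r ^ 2 ≤ M ω ^ 2}ᶜ := (probReal_compl_eq_one_sub hmeas).symm
    _ ≤ _ := by
      refine measureReal_mono fun ω hω => ?_
      have h1 : M ω ^ 2 < r ^ 2 := not_le.1 hω
      have h2 : M ω ≤ r := (lt_of_pow_lt_pow_left₀ 2 hr0.le h1).le
      refine (hpath ω).trans ?_
      calc 2 / η * M ω + C / η ^ 2 * ℓ ≤ 2 / η * r + C / η ^ 2 * ℓ := by gcongr
        _ = C / η ^ 2 * (1 + 6 / √ε) * ℓ := by
          rw [hr]
          field_simp
          ring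

end IsSBP

end PairwiseMRF
end

/-! ### The theorem, in terms of relative errors -/

theorem theorem2 {V X : Type*} [Fintype V] [DecidableEq V] [Fintype X] [Nonempty X]
    {G : SimpleGraph V} [DecidableRel G.Adj] (Ψ : PairwiseMRF G X)
    {η : ℝ} (hη0 : 0 < η) (hη2 : η < 2) (hF : Ψ.IsContractive η)
    {Ω : Type*} [mΩ : MeasurableSpace Ω] (μ : Measure Ω) [IsProbabilityMeasure μ]
    (ℱ : Filtration ℕ mΩ) (m : ℕ → Ω → Messages G X) (J : ℕ → Ω → G.Dart → X) :
    (∃! mstar : Messages G X, Ψ.IsBPFixedPoint mstar) ∧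
    ∀ mstar : Messages G X, Ψ.IsBPFixedPoint mstar →
      -- (a) almost sure convergence, for step sizes of order `1 / t` and positive initial messages
      (∀ (α : ℕ → ℝ) (m₀ : Messages G X),
        (∀ t, 0 < α t ∧ α t ≤ 1) → α =O[atTop] (fun t : ℕ => 1 / (t : ℝ)) → ¬ Summable α →
        (∀ e i, 0 < m₀ (e, i)) → Ψ.IsSBP α m₀ μ ℱ m J →
        ∀ᵐ ω ∂μ, Tendsto (fun t => m t ω) atTop (𝓝 mstar)) ∧
      -- (b) mean-squared error, for step sizes `β / (η (t + 2))` with values in `(0, 1]`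
      (∀ (β : ℝ) (m₀ : Messages G X), 1 < β → β < 2 → β ≤ 2 * η → m₀ ∈ Ψ.feasible →
        Ψ.IsSBP (fun t => β / (η * ((t : ℝ) + 2))) m₀ μ ℱ m J →
        ∀ t : ℕ, 1 ≤ t →
          (∫ ω, ‖m t ω - mstar‖ ^ 2 ∂μ) / ‖mstar‖ ^ 2 ≤
            (3 : ℝ) ^ β * Ψ.prefactor * β ^ 2 / ((2 : ℝ) ^ β * η ^ 2 * (β - 1)) * (1 / (t : ℝ)) +
              ‖m₀ - mstar‖ ^ 2 / ‖mstar‖ ^ 2 * (2 / (t : ℝ)) ^ β) ∧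
      -- (c) step sizes `1 / (η (t + 1))` with values in `(0, 1]`: in expectation and with high
      -- probability
      (∀ m₀ : Messages G X, 1 ≤ η → m₀ ∈ Ψ.feasible →
        Ψ.IsSBP (fun t => 1 / (η * ((t : ℝ) + 1))) m₀ μ ℱ m J →
        (∀ t : ℕ, 1 ≤ t →
          (∫ ω, ‖m t ω - mstar‖ ^ 2 ∂μ) / ‖mstar‖ ^ 2 ≤
            Ψ.prefactor / η ^ 2 * ((1 + Real.log t) / (t : ℝ))) ∧
        (∀ ε : ℝ, 0 < ε → ε < 1 → ∀ t : ℕ, 2 ≤ t →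
          1 - ε ≤ μ.real {ω | ‖m t ω - mstar‖ ^ 2 / ‖mstar‖ ^ 2 ≤
            Ψ.prefactor / η ^ 2 * (1 + 8 / √ε) * ((1 + Real.log t) / (t : ℝ))})) := by
  refine ⟨?_, fun z hz => ⟨fun α m₀ hα hO hns hm₀ h => ?_, fun β m₀ hβ1 hβ2 hβη hm₀ h t ht => ?_,
    fun m₀ hη1 hm₀ h => ?_⟩⟩
  · obtain ⟨z, hz⟩ := hF.exists_fixed hη0 hη2
    exact ⟨z, hz, fun y hy => hF.eq_of_fixed hη0 hy hz⟩
  · exact h.ae_tendsto hη0 hF hz hα hO hns fun p => hm₀ p.1 p.2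
  · have ht1 : (1 : ℝ) ≤ t := Nat.one_le_cast.2 ht
    rcases isEmpty_or_nonempty G.Dart with hG | hG
    · have h0 : ∀ x : Messages G X, ‖x‖ = 0 := fun x => by
        rw [Subsingleton.elim x 0, norm_zero]
      simp [h0, PairwiseMRF.prefactor]
    have hz0 : 0 < ‖z‖ ^ 2 := Ψ.sum_min_pos.trans_le
      (PairwiseMRF.sum_min_le_norm_sq hz.mem_feasible)
    have hβ' : 0 < β - 1 := by linarith
    have hC := PairwiseMRF.feasibleBound_le_prefactor_mul hz.mem_feasible
    have hC0 := Ψ.feasibleBound_pos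
    have hK : 0 < Ψ.prefactor := by
      by_contra hK
      nlinarith
    rw [div_le_iff₀ hz0]
    refine (h.integral_norm_sub_sq_le_of_div_add_two hη0 hF hz hβ1 hβ2 hβη hm₀ t).trans ?_
    -- The recursion gives the bound without the factor `(3 / 2) ^ β`, which is only slack.
    have h32 : (1 : ℝ) ≤ 3 ^ β / 2 ^ β := by
      rw [one_le_div (by positivity)]
      exact Real.rpow_le_rpow (by norm_num) (by norm_num) (by linarith)
    have e1 : β ^ 2 * Ψ.feasibleBound / η ^ 2 / (β - 1) / ((t : ℝ) + 1) ≤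
        (3 : ℝ) ^ β * Ψ.prefactor * β ^ 2 / ((2 : ℝ) ^ β * η ^ 2 * (β - 1)) * (1 / (t : ℝ)) *
          ‖z‖ ^ 2 := by
      calc β ^ 2 * Ψ.feasibleBound / η ^ 2 / (β - 1) / ((t : ℝ) + 1)
          ≤ β ^ 2 * (Ψ.prefactor * ‖z‖ ^ 2) / η ^ 2 / (β - 1) / (t : ℝ) := by
            gcongr
            · nlinarith
            · linarith
        _ ≤ β ^ 2 * (Ψ.prefactor * ‖z‖ ^ 2) / η ^ 2 / (β - 1) / (t : ℝ) * (3 ^ β / 2 ^ β) :=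
            le_mul_of_one_le_right (by positivity) h32
        _ = _ := by
            field_simp
    have e2 : ‖m₀ - z‖ ^ 2 * (2 / ((t : ℝ) + 2)) ^ β ≤
        ‖m₀ - z‖ ^ 2 / ‖z‖ ^ 2 * (2 / (t : ℝ)) ^ β * ‖z‖ ^ 2 := by
      have : ‖m₀ - z‖ ^ 2 / ‖z‖ ^ 2 * (2 / (t : ℝ)) ^ β * ‖z‖ ^ 2 =
          ‖m₀ - z‖ ^ 2 * (2 / (t : ℝ)) ^ β := by
        rw [mul_right_comm, div_mul_cancel₀ _ hz0.ne']
      rw [this]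
      gcongr
      linarith
    rw [add_mul]
    exact add_le_add e1 e2
  · have hα : ∀ t : ℕ, 0 < 1 / (η * ((t : ℝ) + 1)) ∧ 1 / (η * ((t : ℝ) + 1)) ≤ 1 := fun t => by
      have ht : (0 : ℝ) ≤ t := Nat.cast_nonneg t
      refine ⟨by positivity, ?_⟩
      rw [div_le_one (by positivity)]
      nlinarith
    have hfeas := h.mem_feasible hα hm₀
    rcases isEmpty_or_nonempty G.Dart with hG | hG
    · have h0 : ∀ x : Messages G X, ‖x‖ = 0 := fun x => by
        rw [Subsingleton.elim x 0, norm_zero]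
      refine ⟨fun t _ => by simp [h0, PairwiseMRF.prefactor], fun ε hε _ t _ => ?_⟩
      simp [h0, PairwiseMRF.prefactor, hε.le]
    have hz0 : 0 < ‖z‖ ^ 2 := Ψ.sum_min_pos.trans_le
      (PairwiseMRF.sum_min_le_norm_sq hz.mem_feasible)
    have hC := PairwiseMRF.feasibleBound_le_prefactor_mul hz.mem_feasible
    have hC0 := Ψ.feasibleBound_pos
    have hCK : Ψ.feasibleBound ≤ Ψ.prefactor * ‖z‖ ^ 2 := by linarith
    have hKz : 0 ≤ Ψ.prefactor * ‖z‖ ^ 2 := hC0.le.trans hCK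
    refine ⟨fun t ht => ?_, fun ε hε _ t ht => ?_⟩
    · have ht1 : (1 : ℝ) ≤ t := Nat.one_le_cast.2 ht
      have hlog := Real.log_nonneg ht1
      have h1 := h.mul_integral_norm_sub_sq_le_of_div_add_one hη1 hF hz hfeas t
      rw [div_le_iff₀ hz0]
      calc ∫ ω, ‖m t ω - z‖ ^ 2 ∂μ ≤ Ψ.feasibleBound / η ^ 2 * (1 + Real.log t) / t := by
            rwa [le_div_iff₀ (by linarith), mul_comm]
        _ ≤ (Ψ.prefactor * ‖z‖ ^ 2) / η ^ 2 * (1 + Real.log t) / t := by gcongr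
        _ = _ := by ring
    · have ht1 : (1 : ℝ) ≤ t := Nat.one_le_cast.2 (by omega)
      have hlog := Real.log_nonneg ht1
      refine (h.one_sub_le_measureReal_of_div_add_one hη1 hη2 hF hz hfeas hε
        (by omega : 1 ≤ t)).trans (measureReal_mono fun ω hω => ?_)
      have h1 : t * ‖m t ω - z‖ ^ 2 ≤
        Ψ.feasibleBound / η ^ 2 * (1 + 6 / √ε) * (1 + Real.log t) := hω
      have hsε : 0 < √ε := Real.sqrt_pos.2 hε
      show ‖m t ω - z‖ ^ 2 / ‖z‖ ^ 2 ≤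
        Ψ.prefactor / η ^ 2 * (1 + 8 / √ε) * ((1 + Real.log t) / (t : ℝ))
      rw [div_le_iff₀ hz0]
      calc ‖m t ω - z‖ ^ 2
          ≤ Ψ.feasibleBound / η ^ 2 * (1 + 6 / √ε) * (1 + Real.log t) / t := by
            rwa [le_div_iff₀ (by linarith), mul_comm]
        _ ≤ (Ψ.prefactor * ‖z‖ ^ 2) / η ^ 2 * (1 + 8 / √ε) * (1 + Real.log t) / t := by
            gcongr
            norm_num
        _ = _ := by ring
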